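/- Let $q,\beta,\gamma\in\mathbb C$ with $0<|q|<1$, $|\beta|<1$ and $$\left|\frac{q}{\beta^2\gamma}\right|<1,\qquad |q\gamma|<1$$ (with $\beta,\gamma\neq 0$; these conditions force $|q/\beta|<1$). Put $(a;q)_\infty=\prod_{j\ge 0}(1-aq^j)$, and for $k\in\mathbb Z$ let $(a;q)_k=(a;q)_\infty/(aq^k;q)_\infty$ be the $q$-shifted factorial, i.e. $(a;q)_k=\prod_{j=0}^{k-1}(1-aq^j)$ for $k\ge 0$ and $(a;q)_{k}=1/\prod_{j=1}^{-k}(1-aq^{-j})$ for $k<0$ (with $1/(a;q)_k=0$ if this product vanishes); write $(a_1,\dots,a_r;q)_k=(a_1;q)_k\cdots(a_r;q)_k$ for $k\in\mathbb Z\cup\{\infty\}$. For $x=\cos\theta\in[-1,1]$ and $n\in\mathbb Z$ let $$C_n(x;\beta,\gamma\,|\,q)=\sum_{k=-\infty}^\infty\frac{(\beta\gamma;q)_k\,(\beta\gamma;q)_{n-k}}{(q\gamma;q)_k\,(q\gamma;q)_{n-k}}\,e^{\mathrm i(n-2k)\theta}$$ be the bilateral $q$-ultraspherical functions, and let $$w(x\,|\,\beta)=\frac{(e^{2\mathrm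 i\theta},e^{-2\mathrm i\theta};q)_\infty}{(\beta e^{2\mathrm i\theta},\beta e^{-2\mathrm i\theta};q)_\infty}\,\frac1{\sqrt{1-x^2}},$$ which is positive on $(-1,1)$ if $q$ and $\beta$ are real. Let $${}_2\phi_1\!\left[\begin{matrix}a,b\\c\end{matrix};q,z\right]=\sum_{k\ge0}\frac{(a,b;q)_k}{(q,c;q)_k}z^k .$$ Then the series defining $C_n$, the bilateral series over $k$ below (for every $x\in[-1,1]$) and the ${}_2\phi_1$ series below converge absolutely, the integrand below is integrable on $[-1,1]$, and for all $m,n\in\mathbb Z$ $$\frac 1{2\pi}\int_{-1}^1\sum_{k=-\infty}^\infty C_{m+k}(x;\beta,\gamma\,|\,q)\,C_{n+k}(x;\beta,\gamma\,|\,q)\left(\frac q{\beta^2\gamma}\right)^k w(x\,|\,\beta)\,\mathrm dx$$ $$=\frac{(q;q)_\infty^3\,(q/\beta;q)_\infty^4\,(\beta,q\beta;q)_\infty}{(q\gamma,q/\beta\gamma;q)_\infty^4\,(\beta^2;q)_\infty}\;{}_2\phi_1\!\left[\begin{matrix}\beta^2,\beta\\q\beta\end{matrix};q,\frac q{\beta^2\gamma}\right]\left(\frac{\beta^2\gamma}q\right)^n\delta_{m,n}.$$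 Here $q/\beta\gamma$ means $q/(\beta\gamma)$. -/

import Mathlib

/-- The infinite `q`-shifted factorial `(a;q)_∞ = ∏_{j ≥ 0} (1 - a q^j)`. -/
noncomputable def qShiftedInf (a q : ℂ) : ℂ :=
  ∏' j : ℕ, (1 - a * q ^ j)

/-- The `q`-shifted factorial `(a;q)_k` for `k ∈ ℤ`: it is `∏_{0 ≤ j < k} (1 - a q^j)` for `k ≥ 0`
and `1 / ∏_{1 ≤ j ≤ -k} (1 - a q^{-j})` for `k < 0`.  It agrees with `(a;q)_∞ / (a q^k;q)_∞`
whenever that quotient makes sense (see `qShifted_eq_div`), and it gives the usual finite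
products also where numerator and denominator of the quotient both vanish.  When a factor
`1 - a q^{-j}` vanishes, `(a;q)_k` is infinite and `1 / (a;q)_k` is `0`; with Lean's conventions
`1 / qShifted a q k` is `0` in that case too. -/
noncomputable def qShifted (a q : ℂ) : ℤ → ℂ
  | Int.ofNat k => ∏ j ∈ Finset.range k, (1 - a * q ^ j)
  | Int.negSucc k => (∏ j ∈ Finset.range (k + 1), (1 - a * (q ^ (j + 1))⁻¹))⁻¹

/-- The `k`-th term of `₂φ₁[a, b; c; q, z]`. -/
noncomputable def phi21Term (a b c q z : ℂ) (k : ℕ) : ℂ :=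
  qShifted a q k * qShifted b q k / (qShifted q q k * qShifted c q k) * z ^ k

/-- The basic hypergeometric series `₂φ₁[a, b; c; q, z]`. -/
noncomputable def phi21 (a b c q z : ℂ) : ℂ :=
  ∑' k : ℕ, phi21Term a b c q z k

/-- The `k`-th term of the bilateral series defining `C_n(cos θ; β, γ | q)`, `θ ∈ ℂ`. -/
noncomputable def bilateralTerm (q β γ : ℂ) (n : ℤ) (θ : ℂ) (k : ℤ) : ℂ :=
  qShifted (β * γ) q k * qShifted (β * γ) q (n - k) /
      (qShifted (q * γ) q k * qShifted (q * γ) q (n - k)) *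
    Complex.exp (Complex.I * ((n - 2 * k : ℤ) : ℂ) * θ)

/-- The bilateral series defining `C_n(cos θ; β, γ | q)`, as a function of `θ ∈ ℂ`. -/
noncomputable def bilateralTheta (q β γ : ℂ) (n : ℤ) (θ : ℂ) : ℂ :=
  ∑' k : ℤ, bilateralTerm q β γ n θ k

/-- The bilateral `q`-ultraspherical function `C_n(x; β, γ | q)` for `x = cos θ ∈ [-1, 1]`.
The value does not depend on the choice of `θ` (see `bilateralC_eq_of_cos_eq`). -/
noncomputable def bilateralC (q β γ : ℂ) (n : ℤ) (x : ℝ) : ℂ :=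
  bilateralTheta q β γ n (Real.arccos x)

/-- The weight `w(x | β) = (e^{2iθ}, e^{-2iθ};q)_∞ / (β e^{2iθ}, β e^{-2iθ};q)_∞ / √(1 - x²)`,
`x = cos θ`. -/
noncomputable def ultraWeight (q β : ℂ) (x : ℝ) : ℂ :=
  qShiftedInf (Complex.exp (2 * Complex.I * Real.arccos x)) q *
      qShiftedInf (Complex.exp (-(2 * Complex.I * Real.arccos x))) q /
    (qShiftedInf (β * Complex.exp (2 * Complex.I * Real.arccos x)) q *
      qShiftedInf (β * Complex.exp (-(2 * Complex.I * Real.arccos x))) q) /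
    ((Real.sqrt (1 - x ^ 2) : ℝ) : ℂ)

/-- The `k`-th term `C_{m+k}(x) C_{n+k}(x) (q / β²γ)^k` of the shifted product sum. -/
noncomputable def shiftedTerm (q β γ : ℂ) (m n : ℤ) (x : ℝ) (k : ℤ) : ℂ :=
  bilateralC q β γ (m + k) x * bilateralC q β γ (n + k) x * (q / (β ^ 2 * γ)) ^ k

theorem qShiftedInf_multipliable (a : ℂ) {q : ℂ} (hq : ‖q‖ < 1) :
    Multipliable fun j : ℕ => (1 - a * q ^ j) := by
  have h : Summable fun j : ℕ => ‖-(a * q ^ j)‖ := by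
    simpa [norm_mul, norm_pow] using
      (summable_geometric_of_lt_one (norm_nonneg q) hq).mul_left ‖a‖
  simpa [sub_eq_add_neg] using multipliable_one_add_of_summable h

theorem qShiftedInf_split (a : ℂ) {q : ℂ} (hq : ‖q‖ < 1) (k : ℕ) :
    (∏ j ∈ Finset.range k, (1 - a * q ^ j)) * qShiftedInf (a * q ^ k) q = qShiftedInf a q := by
  have h := qShiftedInf_multipliable (a * q ^ k) hq
  have e : (fun j : ℕ => (1 - a * q ^ k * q ^ j)) = fun j : ℕ => (1 - a * q ^ (j + k)) := by
    funext j; rw [pow_add]; ring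
  rw [e] at h
  unfold qShiftedInf
  rw [e]
  exact Multipliable.prod_mul_tprod_nat_mul' (f := fun j : ℕ => (1 - a * q ^ j)) h

theorem qShifted_eq_div (a : ℂ) {q : ℂ} (hq0 : q ≠ 0) (hq : ‖q‖ < 1) (k : ℤ)
    (hk : qShiftedInf (a * q ^ k) q ≠ 0) :
    qShifted a q k = qShiftedInf a q / qShiftedInf (a * q ^ k) q := by
  rw [eq_div_iff hk]
  cases k with
  | ofNat k => simpa [qShifted] using qShiftedInf_split a hq k
  | negSucc k =>
    have h := qShiftedInf_split (a * q ^ Int.negSucc k) hq (k + 1)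
    have e1 : a * q ^ Int.negSucc k * q ^ (k + 1) = a := by
      rw [zpow_negSucc, mul_assoc, inv_mul_cancel₀ (pow_ne_zero _ hq0), mul_one]
    have e2 : ∏ j ∈ Finset.range (k + 1), (1 - a * q ^ Int.negSucc k * q ^ j) =
        ∏ j ∈ Finset.range (k + 1), (1 - a * (q ^ (j + 1))⁻¹) := by
      rw [← Finset.prod_range_reflect]
      refine Finset.prod_congr rfl fun j hj => ?_
      have hj' : j ≤ k := Nat.lt_succ_iff.mp (Finset.mem_range.mp hj)
      have e3 : q ^ (k + 1) = q ^ (k + 1 - 1 - j) * q ^ (j + 1) := by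
        rw [← pow_add]; congr 1; omega
      rw [zpow_negSucc, mul_assoc, e3, mul_inv]
      have := pow_ne_zero (k + 1 - 1 - j) hq0
      have := pow_ne_zero (j + 1) hq0
      field_simp
    rw [e1, e2] at h
    have hne : ∏ j ∈ Finset.range (k + 1), (1 - a * (q ^ (j + 1))⁻¹) ≠ 0 := by
      -- otherwise a factor of the product in the denominator of the quotient vanishes
      intro h0
      rw [Finset.prod_eq_zero_iff] at h0
      obtain ⟨j, hj, hj0⟩ := h0
      apply hk
      have hj' : j ≤ k := Nat.lt_succ_iff.mp (Finset.mem_range.mp hj)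
      have h' := qShiftedInf_split (a * q ^ Int.negSucc k) hq (k + 1)
      rw [← h', e2, Finset.prod_eq_zero hj hj0, zero_mul]
    simp only [qShifted]
    rw [← h, inv_mul_cancel_left₀ hne]

theorem bilateralTheta_eq_of_cos_eq (q β γ : ℂ) (n : ℤ) {θ φ : ℂ}
    (h : Complex.cos θ = Complex.cos φ) : bilateralTheta q β γ n θ = bilateralTheta q β γ n φ := by
  obtain ⟨l, hl⟩ := Complex.cos_eq_cos_iff.mp h
  have per : ∀ k : ℤ, Complex.exp (Complex.I * ((n - 2 * k : ℤ) : ℂ) * (2 * l * Real.pi)) = 1 := by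
    intro k
    rw [Complex.exp_eq_one_iff]
    exact ⟨(n - 2 * k) * l, by push_cast; ring⟩
  rcases hl with hl | hl
  · refine tsum_congr fun k => ?_
    unfold bilateralTerm
    rw [hl, mul_add, Complex.exp_add, per k, one_mul]
  · unfold bilateralTheta
    rw [← (Equiv.subLeft n).tsum_eq]
    refine tsum_congr fun k => ?_
    unfold bilateralTerm
    rw [hl, mul_sub, Complex.exp_sub, per k]
    simp only [Equiv.subLeft_apply, sub_sub_cancel]
    rw [one_div, ← Complex.exp_neg, mul_comm (qShifted (β * γ) q (n - k)),
      mul_comm (qShifted (q * γ) q (n - k))]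
    congr 2
    push_cast
    ring

theorem bilateralC_eq_of_cos_eq (q β γ : ℂ) (n : ℤ) {x : ℝ} (hx : x ∈ Set.Icc (-1 : ℝ) 1) {θ : ℂ}
    (h : Complex.cos θ = x) : bilateralC q β γ n x = bilateralTheta q β γ n θ := by
  apply bilateralTheta_eq_of_cos_eq
  rw [h, ← Complex.ofReal_cos, Real.cos_arccos hx.1 hx.2]

/-! The parameter `γ` can be removed from the shifted product sum, which reduces the theorem to the
orthogonality of the Rogers polynomials (the case `γ = 1`, where `C_n` vanishes for `n < 0`).

By Ramanujan's `₁ψ₁` sum (`hasSum_ramanujan`), the generating function `∑ C_n(cos φ) z^n` is a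
product of two theta-like quotients `psiValue`, at `z e^{-iφ}` and `z e^{iφ}`, for `|q/β| < |z| <
1`. Multiplying it at `z e^{iψ}` and `s e^{-iψ}`, the sum `∑ C_i C_{i-d} (zs)^i` becomes, up to a
power of `s`, the Fourier coefficient of `e^{idψ}`. When `zs = q/(β²γ)`, one has `βγz = q/(βs)` and
`βγs = q/(βz)`, so numerators cancel denominators and `γ` survives only in a constant factor
(`psiValue_mul_psiValue`). Comparing Fourier coefficients gives `shifted_tsum_eq`: the shifted sum
is `psiConst ^ 4` times the one for Rogers polynomials with the same `zs`.

For the Rogers polynomials, a second use of Ramanujan's sum gives the Fourier series of the weight.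
The three-term recurrence then determines the moments of each polynomial, which vanish where needed
(`rogers_moment_eq`), and a Favard-type argument yields orthogonality (`rogers_orthogonality`).
Termwise integration leaves the power series of the squared norms at `q/(β²γ)`, which is the `₂φ₁`.
-/

open Filter Topology

/-! ### Shifted factorials and their quotients. -/

/-- The quotient `(a;q)_k / (b;q)_k` of two `q`-shifted factorials, `k ∈ ℤ`. -/
noncomputable def qRatio (a b q : ℂ) (k : ℤ) : ℂ :=
  qShifted a q k / qShifted b q k

theorem qShifted_natCast (a q : ℂ) (k : ℕ) :
    qShifted a q (k : ℤ) = ∏ j ∈ Finset.range k, (1 - a * q ^ j) := rfl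

theorem qShifted_negSucc (a q : ℂ) (k : ℕ) :
    qShifted a q (Int.negSucc k) =
      (∏ j ∈ Finset.range (k + 1), (1 - a * (q ^ (j + 1))⁻¹))⁻¹ := rfl

theorem qShifted_natCast_succ (a q : ℂ) (k : ℕ) :
    qShifted a q ((k : ℤ) + 1) = qShifted a q k * (1 - a * q ^ k) := by
  rw [← Nat.cast_succ, qShifted_natCast, qShifted_natCast, Finset.prod_range_succ]

@[simp] theorem qRatio_zero (a b q : ℂ) : qRatio a b q 0 = 1 := by
  have h (c : ℂ) : qShifted c q 0 = 1 := by simpa using qShifted_natCast c q 0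
  simp [qRatio, h]

theorem one_sub_ne_zero_of_norm_lt_one {a : ℂ} (ha : ‖a‖ < 1) : 1 - a ≠ 0 := by
  intro h
  rw [← sub_eq_zero.mp h] at ha
  simp at ha

theorem norm_mul_pow_lt_one {a q : ℂ} (hq : ‖q‖ < 1) (ha : ‖a‖ < 1) (j : ℕ) :
    ‖a * q ^ j‖ < 1 := by
  rw [norm_mul, norm_pow]
  exact (mul_le_of_le_one_right (norm_nonneg _) (pow_le_one₀ (norm_nonneg _) hq.le)).trans_lt ha

theorem one_sub_mul_pow_ne_zero {a q : ℂ} (hq : ‖q‖ < 1) (ha : ‖a‖ < 1) (j : ℕ) :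
    1 - a * q ^ j ≠ 0 :=
  one_sub_ne_zero_of_norm_lt_one (norm_mul_pow_lt_one hq ha j)

theorem qShifted_natCast_ne_zero {a q : ℂ} (hq : ‖q‖ < 1) (ha : ‖a‖ < 1) (k : ℕ) :
    qShifted a q k ≠ 0 := by
  rw [qShifted_natCast]
  exact Finset.prod_ne_zero_iff.mpr fun j _ => one_sub_mul_pow_ne_zero hq ha j

theorem qShiftedInf_ne_zero_of_factors {a q : ℂ} (hq : ‖q‖ < 1) (h : ∀ j : ℕ, 1 - a * q ^ j ≠ 0) :
    qShiftedInf a q ≠ 0 := by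
  have hs : Summable fun j : ℕ => ‖-(a * q ^ j)‖ := by
    simpa [norm_mul, norm_pow] using
      (summable_geometric_of_lt_one (norm_nonneg q) hq).mul_left ‖a‖
  have := tprod_one_add_ne_zero_of_summable (f := fun j : ℕ => -(a * q ^ j))
    (by simpa [sub_eq_add_neg] using h) hs
  simpa [qShiftedInf, sub_eq_add_neg] using this

theorem qShiftedInf_ne_zero {a q : ℂ} (hq : ‖q‖ < 1) (ha : ‖a‖ < 1) : qShiftedInf a q ≠ 0 :=
  qShiftedInf_ne_zero_of_factors hq (one_sub_mul_pow_ne_zero hq ha)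

theorem qShiftedInf_succ (a : ℂ) {q : ℂ} (hq : ‖q‖ < 1) :
    qShiftedInf a q = (1 - a) * qShiftedInf (a * q) q := by
  simpa using (qShiftedInf_split a hq 1).symm

theorem tendsto_qShifted (a : ℂ) {q : ℂ} (hq : ‖q‖ < 1) :
    Tendsto (fun k : ℕ => qShifted a q k) atTop (𝓝 (qShiftedInf a q)) :=
  (qShiftedInf_multipliable a hq).hasProd.tendsto_prod_nat

theorem tendsto_qRatio (a : ℂ) {b q : ℂ} (hq : ‖q‖ < 1) (hb : ‖b‖ < 1) :
    Tendsto (fun k : ℕ => qRatio a b q k) atTop (𝓝 (qShiftedInf a q / qShiftedInf b q)) :=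
  (tendsto_qShifted a hq).div (tendsto_qShifted b hq) (qShiftedInf_ne_zero hq hb)

theorem qRatio_q_negSucc (a q : ℂ) (hq0 : q ≠ 0) (k : ℕ) : qRatio a q q (Int.negSucc k) = 0 := by
  -- The factor `1 - q·q⁻¹` vanishes; the convention `0⁻¹ = 0` then reproduces `1/(q;q)_k = 0` for
  -- `k < 0`.
  rw [qRatio, qShifted_negSucc q, Finset.prod_eq_zero (i := 0) (by simp) (by simp [hq0])]
  simp

theorem qRatio_q_of_neg (a q : ℂ) (hq0 : q ≠ 0) {k : ℤ} (hk : k < 0) : qRatio a q q k = 0 := by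
  obtain ⟨n, rfl⟩ := Int.eq_negSucc_of_lt_zero hk
  exact qRatio_q_negSucc a q hq0 n

theorem one_sub_mul_zpow_ne_zero {a q : ℂ} (hq : ‖q‖ < 1) (ha : ‖q‖ < ‖a‖)
    (k : ℕ) : 1 - a * (q ^ (k + 1))⁻¹ ≠ 0 := by
  intro h
  have h1 : q ^ (k + 1) ≠ 0 := by
    intro h0
    simp [h0] at h
  have h2 : a = q ^ (k + 1) := by
    field_simp at h
    linear_combination -h
  rw [h2, norm_pow] at ha
  exact absurd ha (not_lt.mpr (pow_le_of_le_one (norm_nonneg _) hq.le (by simp)))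

/-- The condition on `b` keeps denominators nonzero for `m ≥ 0`, the one on `a` for `m < 0`. Factors
of `b` may vanish at negative indices, so `b = q` is allowed. -/
theorem qRatio_succ {a b q : ℂ} (hq : ‖q‖ < 1) (ha : ‖q‖ < ‖a‖) (hb : ‖b‖ < 1)
    (m : ℤ) : (1 - b * q ^ m) * qRatio a b q (m + 1) = (1 - a * q ^ m) * qRatio a b q m := by
  cases m with
  | ofNat k =>
    have h1 := qShifted_natCast_ne_zero hq hb k
    have h2 := one_sub_mul_pow_ne_zero hq hb k
    simp only [qRatio, Int.ofNat_eq_natCast, qShifted_natCast_succ, zpow_natCast]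
    field_simp
  | negSucc k =>
    have key : ∀ n : ℕ, qRatio a b q (-(n : ℤ)) =
        ∏ j ∈ Finset.range n, ((1 - b * (q ^ (j + 1))⁻¹) / (1 - a * (q ^ (j + 1))⁻¹)) := by
      intro n
      cases n with
      | zero => simp
      | succ n =>
        rw [show -((n + 1 : ℕ) : ℤ) = Int.negSucc n from rfl, qRatio, qShifted_negSucc, qShifted_negSucc, Finset.prod_div_distrib,
          inv_div_inv]
    have e : Int.negSucc k + 1 = -(k : ℤ) := by rw [Int.negSucc_eq]; ring
    have e' : Int.negSucc k = -((k + 1 : ℕ) : ℤ) := by rw [Int.negSucc_eq]; push_cast; ring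
    have := one_sub_mul_zpow_ne_zero hq ha k
    rw [e, e', key, key, Finset.prod_range_succ, zpow_neg, zpow_natCast, mul_comm (Finset.prod _ _),
      ← mul_assoc, mul_div_cancel₀ _ this]

/-! ### The `q`-binomial theorem. -/

theorem exists_norm_qRatio_q_le (a : ℂ) {q : ℂ} (hq0 : q ≠ 0) (hq : ‖q‖ < 1) :
    ∃ M : ℝ, ∀ k : ℤ, ‖qRatio a q q k‖ ≤ M := by
  obtain ⟨M, hM⟩ := (tendsto_qRatio a hq hq).norm.bddAbove_range
  refine ⟨max M 0, fun k => ?_⟩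
  cases k with
  | ofNat k => exact (hM ⟨k, rfl⟩).trans (le_max_left _ _)
  | negSucc k => simp [qRatio_q_negSucc a q hq0 k]

theorem summable_qRatio_q_nat (a : ℂ) {q z : ℂ} (hq0 : q ≠ 0) (hq : ‖q‖ < 1) (hz : ‖z‖ < 1) :
    Summable fun k : ℕ => qRatio a q q k * z ^ k := by
  obtain ⟨M, hM⟩ := exists_norm_qRatio_q_le a hq0 hq
  refine Summable.of_norm_bounded ((summable_geometric_of_lt_one (norm_nonneg z) hz).mul_left M)
    fun k => ?_
  rw [norm_mul, norm_pow]
  gcongr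
  exact hM k

/-- This is the first-order recurrence of the coefficients, multiplied by `z ^ (k + 1)` and summed.
-/
theorem tsum_qRatio_q_functional (a : ℂ) {q z : ℂ} (hq0 : q ≠ 0) (hq : ‖q‖ < 1) (hz : ‖z‖ < 1) :
    (1 - z) * ∑' k : ℕ, qRatio a q q k * z ^ k =
      (1 - a * z) * ∑' k : ℕ, qRatio a q q k * (z * q) ^ k := by
  have hzq : ‖z * q‖ < 1 := by simpa using norm_mul_pow_lt_one hq hz 1
  have s1 := summable_qRatio_q_nat a hq0 hq hz
  have s2 := summable_qRatio_q_nat a hq0 hq hzq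
  have h1 := s1.tsum_eq_zero_add
  have h2 := s2.tsum_eq_zero_add
  have s1' := (summable_nat_add_iff 1).mpr s1
  have s2' := (summable_nat_add_iff 1).mpr s2
  have key : ∑' k : ℕ, (qRatio a q q (k + 1 : ℕ) * z ^ (k + 1) - z * (qRatio a q q k * z ^ k)) =
      ∑' k : ℕ, (qRatio a q q (k + 1 : ℕ) * (z * q) ^ (k + 1) -
        a * z * (qRatio a q q k * (z * q) ^ k)) := by
    refine tsum_congr fun k => ?_
    have h : (1 - q * q ^ k) * qRatio a q q (k + 1 : ℕ) = (1 - a * q ^ k) * qRatio a q q k := by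
      have h1 := qShifted_natCast_ne_zero hq hq k
      have h2 := one_sub_mul_pow_ne_zero hq hq k
      simp only [qRatio, Nat.cast_succ, qShifted_natCast_succ]
      field_simp
    rw [mul_pow, mul_pow]
    linear_combination z ^ (k + 1) * h
  rw [s1'.tsum_sub (s1.mul_left z), s2'.tsum_sub (s2.mul_left (a * z)), tsum_mul_left,
    tsum_mul_left] at key
  simp only [Nat.cast_zero, pow_zero] at h1 h2
  linear_combination key + h1 - h2

/-- The `q`-binomial theorem. -/
theorem tsum_qRatio_q_nat (a : ℂ) {q z : ℂ} (hq0 : q ≠ 0) (hq : ‖q‖ < 1) (hz : ‖z‖ < 1) :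
    ∑' k : ℕ, qRatio a q q k * z ^ k = qShiftedInf (a * z) q / qShiftedInf z q := by
  rw [eq_div_iff (qShiftedInf_ne_zero hq hz)]
  -- Iterating the functional equation moves the argument to `z q^N`, where the series tends to its
  -- constant term `1`.
  have iter : ∀ N : ℕ, (∑' k : ℕ, qRatio a q q k * z ^ k) * qShifted z q N =
      qShifted (a * z) q N * ∑' k : ℕ, qRatio a q q k * (z * q ^ N) ^ k := by
    intro N
    induction N with
    | zero => simp [qShifted]
    | succ N ih =>
      have h := tsum_qRatio_q_functional a hq0 hq (norm_mul_pow_lt_one hq hz N)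
      rw [Nat.cast_succ, qShifted_natCast_succ, qShifted_natCast_succ, ← mul_assoc, ih, pow_succ,
        ← mul_assoc z]
      linear_combination qShifted (a * z) q N * h
  have lim : Tendsto (fun N : ℕ => ∑' k : ℕ, qRatio a q q k * (z * q ^ N) ^ k) atTop (𝓝 1) := by
    obtain ⟨M, hM⟩ := exists_norm_qRatio_q_le a hq0 hq
    have e : (1 : ℂ) = ∑' k : ℕ, if k = 0 then 1 else 0 := by simp
    rw [e]
    refine tendsto_tsum_of_dominated_convergence (bound := fun k => M * ‖z‖ ^ k)
      ((summable_geometric_of_lt_one (norm_nonneg z) hz).mul_left M) (fun k => ?_)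
      (Eventually.of_forall fun N k => ?_)
    · rcases eq_or_ne k 0 with rfl | hk
      · simp
      · have : Tendsto (fun N : ℕ => qRatio a q q k * (z * q ^ N) ^ k) atTop
            (𝓝 (qRatio a q q k * (z * 0) ^ k)) :=
          (((tendsto_pow_atTop_nhds_zero_of_norm_lt_one hq).const_mul z).pow k).const_mul _
        simpa [hk] using this
    · rw [norm_mul, norm_pow, norm_mul, norm_pow]
      gcongr
      · exact (norm_nonneg _).trans (hM 0)
      · exact hM k
      · exact mul_le_of_le_one_right (norm_nonneg _) (pow_le_one₀ (norm_nonneg _) hq.le)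
  refine tendsto_nhds_unique ((tendsto_qShifted z hq).const_mul _) ?_
  simp_rw [iter]
  simpa using (tendsto_qShifted (a * z) hq).mul lim

/-- The `q`-binomial theorem, summed over `ℤ`. -/
theorem hasSum_qRatio_q (a : ℂ) {q z : ℂ} (hq0 : q ≠ 0) (hq : ‖q‖ < 1) (hz : ‖z‖ < 1) :
    HasSum (fun k : ℤ => qRatio a q q k * z ^ k) (qShiftedInf (a * z) q / qShiftedInf z q) := by
  have h := (summable_qRatio_q_nat a hq0 hq hz).hasSum
  rw [tsum_qRatio_q_nat a hq0 hq hz] at h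
  refine (Nat.cast_injective (R := ℤ)).hasSum_iff (f := fun k : ℤ => qRatio a q q k * z ^ k)
    (fun k hk => ?_) |>.mp (by simpa [Function.comp_def] using h)
  rw [qRatio_q_of_neg a q hq0, zero_mul]
  by_contra hk'
  exact hk ⟨k.toNat, by simp; omega⟩

/-! ### Convolution of bilateral series and Ramanujan's sum. -/

theorem hasSum_convolution {f g : ℤ → ℂ} (hf : Summable f) (hg : Summable g) :
    (∀ n, Summable fun k => f k * g (n - k)) ∧
    (Summable fun n => ∑' k, ‖f k * g (n - k)‖) ∧
    HasSum (fun n => ∑' k, f k * g (n - k)) ((∑' k, f k) * ∑' k, g k) := by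
  let e : ℤ × ℤ ≃ ℤ × ℤ :=
    { toFun := fun p => (p.2, p.1 - p.2)
      invFun := fun p => (p.1 + p.2, p.1)
      left_inv := fun p => by simp
      right_inv := fun p => by simp }
  have h0 := summable_mul_of_summable_norm hf.norm hg.norm
  have h1 : Summable fun p : ℤ × ℤ => f p.2 * g (p.1 - p.2) := e.summable_iff.mpr h0
  have h2 : ∀ n, Summable fun k => f k * g (n - k) := fun n => h1.prod_factor n
  refine ⟨h2, h1.norm.prod, ?_⟩
  have h3 := h1.hasSum.prod_fiberwise (fun n => (h2 n).hasSum)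
  have h4 : ∑' p : ℤ × ℤ, f p.2 * g (p.1 - p.2) = (∑' k, f k) * ∑' k, g k := by
    rw [tsum_mul_tsum_of_summable_norm hf.norm hg.norm]
    exact e.tsum_eq (fun p : ℤ × ℤ => f p.1 * g p.2)
  rwa [h4] at h3

section Ramanujan

variable {a b q : ℂ}

theorem summable_qRatio_mul_qRatio (a b : ℂ) (hq0 : q ≠ 0) (hq : ‖q‖ < 1) {w : ℂ} (hw : ‖w‖ < 1)
    (m : ℤ) : Summable fun l : ℤ => qRatio a q q (m + l) * (qRatio (q / b) q q l * w ^ l) := by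
  obtain ⟨M, hM⟩ := exists_norm_qRatio_q_le a hq0 hq
  refine Summable.of_norm_bounded ((hasSum_qRatio_q (q / b) hq0 hq hw).summable.norm.mul_left M)
    fun l => ?_
  rw [norm_mul]
  gcongr
  exact hM _

/-- The coefficient of `z ^ m` in the product of two `q`-binomial series in `z` and `b / (a z)`. -/
noncomputable def psiCoeff (a b q : ℂ) (m : ℤ) : ℂ :=
  ∑' l : ℤ, qRatio a q q (m + l) * (qRatio (q / b) q q l * (b / a) ^ l)

theorem norm_lt_of_div {b : ℂ} (hq0 : q ≠ 0) (hb0 : b ≠ 0) (hb : ‖b‖ < 1) : ‖q‖ < ‖q / b‖ := by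
  rw [norm_div, lt_div_iff₀ (norm_pos_iff.mpr hb0)]
  exact mul_lt_of_lt_one_right (norm_pos_iff.mpr hq0) hb

/-- Let `B` be the same sum with `b / a` replaced by `q b / a`. The recurrence of the first factor
gives one relation between the coefficients and `B`, that of the second factor, after a shift of the
summation index, gives another; eliminating `B` leaves the recurrence. -/
theorem psiCoeff_succ (hq0 : q ≠ 0) (hq : ‖q‖ < 1) (ha : ‖q‖ < ‖a‖) (hb0 : b ≠ 0) (hb : ‖b‖ < 1)
    (hba : ‖b / a‖ < 1) (m : ℤ) :
    (1 - b * q ^ m) * psiCoeff a b q (m + 1) = (1 - a * q ^ m) * psiCoeff a b q m := by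
  have ha0 : a ≠ 0 := norm_pos_iff.mp ((norm_nonneg q).trans_lt ha)
  set c := b / a with hc
  have hac : a * c = b := by rw [hc]; field_simp
  have hc0 : c ≠ 0 := div_ne_zero hb0 ha0
  have hcq : ‖c * q‖ < 1 := by simpa using norm_mul_pow_lt_one hq hba 1
  have sA := summable_qRatio_mul_qRatio a b hq0 hq hba
  have sB := summable_qRatio_mul_qRatio a b hq0 hq hcq
  set B : ℤ → ℂ := fun m => ∑' l : ℤ,
    qRatio a q q (m + l) * (qRatio (q / b) q q l * (c * q) ^ l) with hB
  have h1 : psiCoeff a b q (m + 1) - psiCoeff a b q m = q ^ m * (q * B (m + 1) - a * B m) := by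
    simp only [psiCoeff, hB, ← hc]
    rw [← (sA _).tsum_sub (sA _), ← tsum_mul_left, ← tsum_mul_left,
      ← ((sB _).mul_left _).tsum_sub ((sB _).mul_left _), ← tsum_mul_left]
    refine tsum_congr fun l => ?_
    have h := qRatio_succ (b := q) hq ha hq (m + l)
    rw [add_right_comm m 1 l, mul_zpow]
    rw [zpow_add₀ hq0] at h
    linear_combination (qRatio (q / b) q q l * c ^ l) * h
  have h2 : a * psiCoeff a b q m - a * B m = b * psiCoeff a b q (m + 1) - q * B (m + 1) := by
    simp only [psiCoeff, hB, ← hc]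
    simp only [← tsum_mul_left]
    rw [← ((sA _).mul_left _).tsum_sub ((sB _).mul_left _),
      ← ((sA _).mul_left _).tsum_sub ((sB _).mul_left _),
      ← (Equiv.addRight (1 : ℤ)).tsum_eq]
    refine tsum_congr fun l => ?_
    have h := qRatio_succ (b := q) hq (norm_lt_of_div hq0 hb0 hb) hq l
    have e : b * (q / b) = q := by field_simp
    simp only [Equiv.coe_addRight]
    rw [add_right_comm m 1 l, add_assoc m l 1, mul_zpow, mul_zpow, zpow_add_one₀ hc0,
      zpow_add_one₀ hq0]
    linear_combination (qRatio a q q (m + (l + 1)) * c ^ l * a * c) * h +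
      qRatio a q q (m + (l + 1)) * c ^ l * qRatio (q / b) q q l * (1 - q / b * q ^ l) * hac -
      qRatio a q q (m + (l + 1)) * c ^ l * qRatio (q / b) q q l * q ^ l * e
  linear_combination h1 + q ^ m * h2

theorem psiCoeff_eq_mul_qRatio (hq0 : q ≠ 0) (hq : ‖q‖ < 1) (ha : ‖q‖ < ‖a‖) (hb0 : b ≠ 0)
    (hb : ‖b‖ < 1) (hba : ‖b / a‖ < 1) (m : ℤ) :
    psiCoeff a b q m = psiCoeff a b q 0 * qRatio a b q m := by
  induction m with
  | zero => simp
  | succ k ih =>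
    have h1 := psiCoeff_succ hq0 hq ha hb0 hb hba k
    have h2 := qRatio_succ hq ha hb k
    have h3 := one_sub_mul_pow_ne_zero hq hb k
    rw [zpow_natCast] at h1 h2
    refine mul_left_cancel₀ h3 ?_
    linear_combination h1 - psiCoeff a b q 0 * h2 + (1 - a * q ^ k) * ih
  | pred k ih =>
    have h1 := psiCoeff_succ hq0 hq ha hb0 hb hba (-k - 1)
    have h2 := qRatio_succ hq ha hb (-k - 1)
    have h3 := one_sub_mul_zpow_ne_zero hq ha k
    rw [show q ^ (-(k : ℤ) - 1) = (q ^ (k + 1))⁻¹ by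
      rw [← zpow_natCast, ← zpow_neg]; congr 1; push_cast; ring, sub_add_cancel] at h1 h2
    refine mul_left_cancel₀ h3 ?_
    linear_combination -h1 + psiCoeff a b q 0 * h2 + (1 - b * (q ^ (k + 1))⁻¹) * ih

theorem tendsto_psiCoeff (hq0 : q ≠ 0) (hq : ‖q‖ < 1) (hb0 : b ≠ 0) (hba : ‖b / a‖ < 1) :
    Tendsto (fun N : ℕ => psiCoeff a b q N) atTop
      (𝓝 (qShiftedInf a q / qShiftedInf q q *
        (qShiftedInf (q / a) q / qShiftedInf (b / a) q))) := by
  have hs := hasSum_qRatio_q (q / b) hq0 hq hba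
  rw [show q / b * (b / a) = q / a by field_simp] at hs
  rw [← hs.tsum_eq, ← tsum_mul_left]
  obtain ⟨M, hM⟩ := exists_norm_qRatio_q_le a hq0 hq
  refine tendsto_tsum_of_dominated_convergence (hs.summable.norm.mul_left M) (fun l => ?_)
    (Eventually.of_forall fun N l => ?_)
  · refine Tendsto.mul_const _ ?_
    have h1 : Tendsto (fun N : ℕ => ((N : ℤ) + l).toNat) atTop atTop :=
      tendsto_atTop_atTop.mpr fun n => ⟨n + l.natAbs, fun N hN => by omega⟩
    refine ((tendsto_qRatio a hq hq).comp h1).congr' ?_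
    filter_upwards [eventually_ge_atTop l.natAbs] with N hN
    simp only [Function.comp_apply]
    congr 1
    omega
  · rw [norm_mul]
    gcongr
    exact hM _

/-- The constant is found by letting the index tend to infinity in `psiCoeff_eq_mul_qRatio`, which
works as long as `(a;q)_∞ ≠ 0`. -/
theorem psiCoeff_zero (hq0 : q ≠ 0) (hq : ‖q‖ < 1) (ha : ‖q‖ < ‖a‖) (hb0 : b ≠ 0)
    (hb : ‖b‖ < 1) (hba : ‖b / a‖ < 1) :
    psiCoeff a b q 0 = qShiftedInf b q * qShiftedInf (q / a) q /
      (qShiftedInf q q * qShiftedInf (b / a) q) := by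
  have hm := psiCoeff_eq_mul_qRatio hq0 hq ha hb0 hb hba
  have ha0 : a ≠ 0 := norm_pos_iff.mp ((norm_nonneg q).trans_lt ha)
  have hB := qShiftedInf_ne_zero hq hb
  have hQ := qShiftedInf_ne_zero hq hq
  have hC := qShiftedInf_ne_zero hq hba
  by_cases h : ∀ j : ℕ, 1 - a * q ^ j ≠ 0
  · have hA := qShiftedInf_ne_zero_of_factors hq h
    have h1 := tendsto_psiCoeff (a := a) hq0 hq hb0 hba
    have h2 := tendsto_nhds_unique (h1.congr fun N : ℕ => hm (N : ℤ)) ((tendsto_qRatio a hq hb).const_mul _)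
    have h3 : qShiftedInf (q / a) q / (qShiftedInf q q * qShiftedInf (b / a) q) =
        psiCoeff a b q 0 / qShiftedInf b q := by
      refine mul_left_cancel₀ hA ?_
      linear_combination h2
    rw [eq_div_iff hB] at h3
    rw [← h3]
    ring
  -- Here `a = q^{-j}` and the limit only says `0 = 0`. The coefficient at index `j` is used
  -- instead: its sum reduces to the term `l = 0`, since `(a;q)_k` vanishes for `k > j` and the
  -- second factor vanishes for `l < 0`.
  · push Not at h
    classical
    let j := Nat.find h
    have hj : 1 - a * q ^ j = 0 := Nat.find_spec h
    have hlt : ∀ i < j, 1 - a * q ^ i ≠ 0 := fun i hi => Nat.find_min h hi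
    have hA : qShifted a q j ≠ 0 := by
      rw [qShifted_natCast]
      exact Finset.prod_ne_zero_iff.mpr fun i hi => hlt i (Finset.mem_range.mp hi)
    have h1 : psiCoeff a b q j = qRatio a q q j := by
      rw [psiCoeff, tsum_eq_single 0]
      · simp
      · intro l hl
        rcases lt_or_gt_of_ne hl with hl | hl
        · rw [qRatio_q_of_neg _ q hq0 hl]
          ring
        · obtain ⟨i, rfl⟩ : ∃ i : ℕ, l = i + 1 := ⟨(l - 1).toNat, by omega⟩
          have : qShifted a q ((j : ℤ) + ((i : ℤ) + 1)) = 0 := by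
            rw [show (j : ℤ) + ((i : ℤ) + 1) = ((j + i + 1 : ℕ) : ℤ) by push_cast; ring,
              qShifted_natCast]
            exact Finset.prod_eq_zero (i := j) (Finset.mem_range.mpr (by omega)) hj
          rw [qRatio, this]
          ring
    have hqa : (1 : ℂ) / a = q ^ j := by
      field_simp
      linear_combination hj
    have e1 := qShiftedInf_split b hq j
    have e2 := qShiftedInf_split q hq j
    rw [← qShifted_natCast] at e1 e2
    have h2 := hm j
    rw [h1, qRatio, qRatio] at h2
    have hb' := qShifted_natCast_ne_zero hq hb j
    have hq' := qShifted_natCast_ne_zero hq hq j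
    rw [div_eq_mul_one_div b, div_eq_mul_one_div q, hqa] at *
    have h3 : psiCoeff a b q 0 = qShifted b q j / qShifted q q j := by
      field_simp at h2 ⊢
      linear_combination -h2
    have hQ' : qShiftedInf (q * q ^ j) q ≠ 0 := fun h0 => hQ (by rw [← e2, h0, mul_zero])
    have hB' : qShiftedInf (b * q ^ j) q ≠ 0 := fun h0 => hB (by rw [← e1, h0, mul_zero])
    rw [h3, ← e1, ← e2]
    generalize qShiftedInf (q * q ^ j) q = Q at *
    generalize qShiftedInf (b * q ^ j) q = B at *
    field_simp

/-- Ramanujan's `₁ψ₁` summation. -/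
theorem hasSum_ramanujan (hq0 : q ≠ 0) (hq : ‖q‖ < 1) (ha : ‖q‖ < ‖a‖) (hb0 : b ≠ 0)
    (hb : ‖b‖ < 1) {z : ℂ} (hz0 : z ≠ 0) (hz : ‖z‖ < 1)
    (hbz : ‖b / (a * z)‖ < 1) :
    HasSum (fun m : ℤ => qRatio a b q m * z ^ m)
      (qShiftedInf q q * qShiftedInf (b / a) q *
          (qShiftedInf (a * z) q * qShiftedInf (q / (a * z)) q) /
        (qShiftedInf b q * qShiftedInf (q / a) q *
          (qShiftedInf z q * qShiftedInf (b / (a * z)) q))) := by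
  have ha0 : a ≠ 0 := norm_pos_iff.mp ((norm_nonneg q).trans_lt ha)
  have hba : ‖b / a‖ < 1 := by
    rw [show b / a = b / (a * z) * z by field_simp, norm_mul]
    exact mul_lt_one_of_nonneg_of_lt_one_left (norm_nonneg _) hbz hz.le
  have hf := hasSum_qRatio_q a hq0 hq hz
  have hg := hasSum_qRatio_q (q / b) hq0 hq hbz
  rw [show q / b * (b / (a * z)) = q / (a * z) by field_simp] at hg
  have hg' := (Equiv.neg ℤ).hasSum_iff.mpr hg
  have h := (hasSum_convolution hf.summable hg'.summable).2.2
  rw [hf.tsum_eq, hg'.tsum_eq] at h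
  -- The second binomial series runs in `b / (a z)`, so it contributes negative powers of `z`, and
  -- collecting `z ^ m` gives `psiCoeff`.
  have hcoef : ∀ m : ℤ, (∑' k : ℤ, qRatio a q q k * z ^ k *
      ((fun k : ℤ => qRatio (q / b) q q k * (b / (a * z)) ^ k) ∘ Equiv.neg ℤ) (m - k)) =
      psiCoeff a b q 0 * (qRatio a b q m * z ^ m) := by
    intro m
    rw [← mul_assoc, ← psiCoeff_eq_mul_qRatio hq0 hq ha hb0 hb hba, psiCoeff, ← tsum_mul_right,
      ← (Equiv.addLeft m).tsum_eq]
    refine tsum_congr fun l => ?_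
    simp only [Equiv.coe_addLeft, Function.comp_apply, Equiv.neg_apply]
    rw [show -(m - (m + l)) = l by ring, show b / (a * z) = b / a * z⁻¹ by field_simp, mul_zpow,
      zpow_add₀ hz0, inv_zpow]
    have := zpow_ne_zero l hz0
    field_simp
  simp_rw [hcoef] at h
  have hB := qShiftedInf_ne_zero hq hb
  have hQ := qShiftedInf_ne_zero hq hq
  have hC := qShiftedInf_ne_zero hq hba
  have hA : qShiftedInf (q / a) q ≠ 0 := by
    refine qShiftedInf_ne_zero hq ?_
    rw [norm_div]
    exact (div_lt_one ((norm_nonneg q).trans_lt ha)).mpr ha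
  have h0 : psiCoeff a b q 0 ≠ 0 := by
    rw [psiCoeff_zero hq0 hq ha hb0 hb hba]
    positivity
  have h' := h.mul_left (psiCoeff a b q 0)⁻¹
  simp only [inv_mul_cancel_left₀ h0] at h'
  rw [psiCoeff_zero hq0 hq ha hb0 hb hba] at h'
  have e : qShiftedInf q q * qShiftedInf (b / a) q *
          (qShiftedInf (a * z) q * qShiftedInf (q / (a * z)) q) /
        (qShiftedInf b q * qShiftedInf (q / a) q *
          (qShiftedInf z q * qShiftedInf (b / (a * z)) q)) =
      (qShiftedInf b q * qShiftedInf (q / a) q /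
        (qShiftedInf q q * qShiftedInf (b / a) q))⁻¹ *
      (qShiftedInf (a * z) q / qShiftedInf z q *
        (qShiftedInf (q / (a * z)) q / qShiftedInf (b / (a * z)) q)) := by
    rw [inv_div, div_mul_div_comm, div_mul_div_comm]
  rwa [e]

end Ramanujan

/-! ### Fourier modes. -/

/-- The exponential `φ ↦ e^{i n φ}` as a continuous function on `ℝ`. -/
noncomputable def phase (n : ℤ) : C(ℝ, ℂ) :=
  ⟨fun φ => Complex.exp (Complex.I * n * φ), by fun_prop⟩

theorem phase_apply (n : ℤ) (φ : ℝ) : phase n φ = Complex.exp (Complex.I * n * φ) := rfl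

@[simp] theorem phase_zero : phase 0 = 1 := by
  ext φ
  simp [phase_apply]

theorem phase_add (m n : ℤ) : phase (m + n) = phase m * phase n := by
  ext φ
  rw [ContinuousMap.mul_apply, phase_apply, phase_apply, phase_apply, ← Complex.exp_add]
  congr 1
  push_cast
  ring

theorem phase_eq_zpow (n : ℤ) (φ : ℝ) : phase n φ = phase 1 φ ^ n := by
  rw [phase_apply, phase_apply, ← Complex.exp_int_mul]
  congr 1
  push_cast
  ring

@[simp] theorem norm_phase (n : ℤ) (φ : ℝ) : ‖phase n φ‖ = 1 := by
  rw [phase_apply, show Complex.I * n * φ = ((n * φ : ℝ) : ℂ) * Complex.I by push_cast; ring,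
    Complex.norm_exp_ofReal_mul_I]

theorem phase_ne_zero (n : ℤ) (φ : ℝ) : phase n φ ≠ 0 := Complex.exp_ne_zero _

theorem bilateralTerm_eq (q β γ : ℂ) (n : ℤ) (φ : ℝ) (k : ℤ) :
    bilateralTerm q β γ n φ k =
      qRatio (β * γ) (q * γ) q k * qRatio (β * γ) (q * γ) q (n - k) * phase (n - 2 * k) φ := by
  rw [bilateralTerm, qRatio, qRatio, div_mul_div_comm, phase_apply]

/-! ### The generating function of the bilateral functions. -/

section Bilateral

variable {q β γ : ℂ}

/-- The admissible annulus `|q / β| < |z| < 1`. -/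
def InAnnulus (q β z : ℂ) : Prop := ‖q‖ < ‖β * z‖ ∧ ‖z‖ < 1

theorem InAnnulus.ne_zero {z : ℂ} (h : InAnnulus q β z) : z ≠ 0 := by
  rintro rfl
  have := h.1
  simp only [mul_zero, norm_zero] at this
  exact absurd this (not_lt.mpr (norm_nonneg q))

theorem InAnnulus.left_ne_zero {z : ℂ} (h : InAnnulus q β z) : β ≠ 0 := by
  rintro rfl
  have := h.1
  simp only [zero_mul, norm_zero] at this
  exact absurd this (not_lt.mpr (norm_nonneg q))

theorem InAnnulus.norm_div_lt {z : ℂ} (h : InAnnulus q β z) : ‖q / (β * z)‖ < 1 := by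
  rw [norm_div]
  exact (div_lt_one ((norm_nonneg q).trans_lt h.1)).mpr h.1

theorem InAnnulus.mul_phase {z : ℂ} (h : InAnnulus q β z) (n : ℤ) (φ : ℝ) :
    InAnnulus q β (z * phase n φ) := by
  refine ⟨?_, ?_⟩
  · rw [← mul_assoc, norm_mul _ (phase n φ), norm_phase, mul_one]
    exact h.1
  · rw [norm_mul, norm_phase, mul_one]
    exact h.2

/-- Ramanujan's sum for the one-sided factor of the generating function. -/
noncomputable def psiValue (q β γ z : ℂ) : ℂ :=
  qShiftedInf q q * qShiftedInf (q / β) q *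
      (qShiftedInf (β * γ * z) q * qShiftedInf (q / (β * γ * z)) q) /
    (qShiftedInf (q * γ) q * qShiftedInf (q / (β * γ)) q *
      (qShiftedInf z q * qShiftedInf (q / (β * z)) q))

theorem ne_zero_of_norm_lt_mul (ha : ‖q‖ < ‖β * γ‖) : γ ≠ 0 := by
  rintro rfl
  simp only [mul_zero, norm_zero] at ha
  exact absurd ha (not_lt.mpr (norm_nonneg q))

theorem hasSum_psiValue (hq0 : q ≠ 0) (hq : ‖q‖ < 1) (ha : ‖q‖ < ‖β * γ‖) (hb : ‖q * γ‖ < 1)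
    {z : ℂ} (hz : InAnnulus q β z) :
    HasSum (fun k : ℤ => qRatio (β * γ) (q * γ) q k * z ^ k) (psiValue q β γ z) := by
  have hγ := ne_zero_of_norm_lt_mul ha
  have hβ := hz.left_ne_zero
  have hz0 := hz.ne_zero
  have e : q * γ / (β * γ * z) = q / (β * z) := by field_simp
  have e' : q * γ / (β * γ) = q / β := by field_simp
  have h := hasSum_ramanujan hq0 hq ha (mul_ne_zero hq0 hγ) hb hz0 hz.2
    (by rw [e]; exact hz.norm_div_lt)
  rwa [e, e'] at h

/-- Ramanujan's series at `z e^{-iφ}` and at `z e^{iφ}` are convolved. The middle claim records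
majorants independent of `φ`, which later justify integrating term by term. -/
theorem bilateral_convolution (hq0 : q ≠ 0) (hq : ‖q‖ < 1) (ha : ‖q‖ < ‖β * γ‖)
    (hb : ‖q * γ‖ < 1) {z : ℂ} (hz : InAnnulus q β z) (φ : ℝ) :
    (∀ n, Summable (bilateralTerm q β γ n φ)) ∧
    (Summable fun n : ℤ => ‖z‖ ^ n *
      ∑' k : ℤ, ‖qRatio (β * γ) (q * γ) q k * qRatio (β * γ) (q * γ) q (n - k)‖) ∧
    HasSum (fun n : ℤ => z ^ n * bilateralTheta q β γ n φ)
      (psiValue q β γ (z * phase (-1) φ) * psiValue q β γ (z * phase 1 φ)) := by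
  have hf := hasSum_psiValue hq0 hq ha hb (hz.mul_phase (-1) φ)
  have hg := hasSum_psiValue hq0 hq ha hb (hz.mul_phase 1 φ)
  obtain ⟨h1, h2, h3⟩ := hasSum_convolution hf.summable hg.summable
  have hz0 := hz.ne_zero
  have key : ∀ n k : ℤ, qRatio (β * γ) (q * γ) q k * (z * phase (-1) φ) ^ k *
      (qRatio (β * γ) (q * γ) q (n - k) * (z * phase 1 φ) ^ (n - k)) =
      z ^ n * bilateralTerm q β γ n φ k := by
    intro n k
    have hp := phase_ne_zero 1 φ
    have e : phase (n - 2 * k) φ = (phase 1 φ)⁻¹ ^ k * phase 1 φ ^ (n - k) := by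
      rw [phase_eq_zpow, inv_zpow, ← zpow_neg, ← zpow_add₀ hp]
      congr 1
      ring
    have e' : z ^ n = z ^ k * z ^ (n - k) := by
      rw [← zpow_add₀ hz0]
      congr 1
      ring
    rw [bilateralTerm_eq, mul_zpow, mul_zpow, phase_eq_zpow (-1), zpow_neg_one, e, e']
    ring
  simp_rw [key] at h1 h2 h3
  refine ⟨fun n => ?_, ?_, ?_⟩
  · exact (summable_mul_left_iff (zpow_ne_zero n hz0)).mp (h1 n)
  · refine h2.congr fun n => ?_
    rw [← tsum_mul_left]
    refine tsum_congr fun k => ?_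
    rw [bilateralTerm_eq, norm_mul, norm_mul _ (phase _ _), norm_phase, mul_one, norm_zpow]
  · rw [hf.tsum_eq, hg.tsum_eq] at h3
    refine h3.congr_fun fun n => ?_
    rw [tsum_mul_left, bilateralTheta]

end Bilateral

/-! ### The mean over the circle and Fourier coefficients. -/

/-- The mean `(2π)⁻¹ ∫_0^{2π} f` as a linear functional on continuous functions. -/
noncomputable def circleMean : C(ℝ, ℂ) →ₗ[ℂ] ℂ where
  toFun f := 1 / (2 * (Real.pi : ℂ)) * ∫ φ in (0 : ℝ)..(2 * Real.pi), f φ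
  map_add' f g := by
    simp only [ContinuousMap.add_apply]
    rw [intervalIntegral.integral_add (f.continuous.intervalIntegrable _ _)
      (g.continuous.intervalIntegrable _ _), mul_add]
  map_smul' c f := by
    simp only [ContinuousMap.smul_apply, smul_eq_mul, RingHom.id_apply,
      intervalIntegral.integral_const_mul]
    ring

theorem circleMean_apply (f : C(ℝ, ℂ)) :
    circleMean f = 1 / (2 * (Real.pi : ℂ)) * ∫ φ in (0 : ℝ)..(2 * Real.pi), f φ := rfl

theorem circleMean_phase (n : ℤ) : circleMean (phase n) = if n = 0 then 1 else 0 := by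
  have hpi : (Real.pi : ℂ) ≠ 0 := by exact_mod_cast Real.pi_ne_zero
  rw [circleMean_apply]
  split_ifs with h
  · subst h
    simp
    field_simp
  · have hc : Complex.I * (n : ℂ) ≠ 0 := mul_ne_zero Complex.I_ne_zero (by exact_mod_cast h)
    simp only [phase_apply]
    rw [integral_exp_mul_complex hc]
    have : Complex.exp (Complex.I * n * ((2 * Real.pi : ℝ) : ℂ)) = 1 := by
      rw [Complex.exp_eq_one_iff]
      exact ⟨n, by push_cast; ring⟩
    rw [this]
    simp

theorem hasSum_circleMean {f : ℤ → C(ℝ, ℂ)} {F : C(ℝ, ℂ)} {b : ℤ → ℝ} (hb : Summable b)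
    (hfb : ∀ k φ, ‖f k φ‖ ≤ b k) (hF : ∀ φ, HasSum (fun k => f k φ) (F φ)) :
    HasSum (fun k => circleMean (f k)) (circleMean F) := by
  simp only [circleMean_apply]
  refine HasSum.mul_left _ ?_
  exact intervalIntegral.hasSum_integral_of_dominated_convergence (fun k _ => b k)
    (fun k => (f k).continuous.aestronglyMeasurable)
    (fun k => Eventually.of_forall fun φ _ => hfb k φ)
    (Eventually.of_forall fun φ _ => hb)
    (by simp)
    (Eventually.of_forall fun φ _ => hF φ)

theorem circleMean_phase_mul {c : ℤ → ℂ} (p : ℤ → ℤ) (hc : Summable c) {F : C(ℝ, ℂ)}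
    (hF : ∀ φ, HasSum (fun k => c k * phase (p k) φ) (F φ)) (i : ℤ) :
    circleMean (phase i * F) = ∑' k, c k * if i + p k = 0 then 1 else 0 := by
  have h := hasSum_circleMean (f := fun k => c k • phase (i + p k)) (F := phase i * F)
    hc.norm (fun k φ => by simp) (fun φ => by
      refine ((hF φ).mul_left (phase i φ)).congr_fun fun k => ?_
      rw [ContinuousMap.smul_apply, phase_add, ContinuousMap.mul_apply, smul_eq_mul]
      ring)
  rw [← h.tsum_eq]
  simp [circleMean_phase]

theorem phase_series_unique {c d : ℤ → ℂ} (hc : Summable c) (hd : Summable d)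
    (h : ∀ φ, ∑' k, c k * phase k φ = ∑' k, d k * phase k φ) : c = d := by
  have sc : ∀ φ, Summable fun k => c k * phase k φ := fun φ =>
    Summable.of_norm_bounded hc.norm fun k => by simp
  have sd : ∀ φ, Summable fun k => d k * phase k φ := fun φ =>
    Summable.of_norm_bounded hd.norm fun k => by simp
  let F : C(ℝ, ℂ) := ⟨fun φ => ∑' k, c k * phase k φ,
    continuous_tsum (fun k => continuous_const.mul (phase k).continuous) hc.norm
      fun k φ => by simp⟩
  funext n
  have h1 := circleMean_phase_mul (F := F) id hc (fun φ => (sc φ).hasSum) (-n)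
  have h2 := circleMean_phase_mul (F := F) id hd (fun φ => by
    have := (sd φ).hasSum
    rwa [← h φ] at this) (-n)
  have e : ∀ k : ℤ, -n + id k = 0 ↔ k = n := fun k => by simp only [id]; omega
  simp only [e, mul_ite, mul_one, mul_zero, tsum_ite_eq] at h1 h2
  rw [← h1, h2]

/-! ### Shifted products and the removal of `γ`. -/

section Shift

variable {q β γ : ℂ}

/-- In the product of the generating functions at `z e^{iψ}` and `s e^{-iψ}`, the pair of indices
`(i, i - d)` carries the phase `e^{idψ}`, so fixing the Fourier mode in `ψ` fixes the difference of
the indices. -/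
theorem hasSum_shifted_product (hq0 : q ≠ 0) (hq : ‖q‖ < 1) (ha : ‖q‖ < ‖β * γ‖)
    (hb : ‖q * γ‖ < 1) {z s : ℂ} (hz : InAnnulus q β z) (hs : InAnnulus q β s) (φ : ℝ) :
    (∀ d, Summable fun i : ℤ => bilateralTheta q β γ i φ * bilateralTheta q β γ (i - d) φ *
      (z * s) ^ i) ∧
    (Summable fun d : ℤ => s ^ (-d) * ∑' i : ℤ, bilateralTheta q β γ i φ *
      bilateralTheta q β γ (i - d) φ * (z * s) ^ i) ∧
    ∀ ψ, HasSum (fun d : ℤ => (s ^ (-d) * ∑' i : ℤ, bilateralTheta q β γ i φ *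
      bilateralTheta q β γ (i - d) φ * (z * s) ^ i) * phase d ψ)
      (psiValue q β γ (z * phase 1 ψ * phase (-1) φ) * psiValue q β γ (z * phase 1 ψ * phase 1 φ) *
        (psiValue q β γ (s * phase (-1) ψ * phase (-1) φ) *
          psiValue q β γ (s * phase (-1) ψ * phase 1 φ))) := by
  have main : ∀ ψ, (∀ d, Summable fun i : ℤ => s ^ (-d) * phase d ψ * (bilateralTheta q β γ i φ *
      bilateralTheta q β γ (i - d) φ * (z * s) ^ i)) ∧
      HasSum (fun d : ℤ => (s ^ (-d) * ∑' i : ℤ, bilateralTheta q β γ i φ *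
      bilateralTheta q β γ (i - d) φ * (z * s) ^ i) * phase d ψ)
      (psiValue q β γ (z * phase 1 ψ * phase (-1) φ) * psiValue q β γ (z * phase 1 ψ * phase 1 φ) *
        (psiValue q β γ (s * phase (-1) ψ * phase (-1) φ) *
          psiValue q β γ (s * phase (-1) ψ * phase 1 φ))) := by
    intro ψ
    have hf := (bilateral_convolution hq0 hq ha hb (hz.mul_phase 1 ψ) φ).2.2
    have hg := (bilateral_convolution hq0 hq ha hb (hs.mul_phase (-1) ψ) φ).2.2
    have hg' := (Equiv.neg ℤ).hasSum_iff.mpr hg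
    obtain ⟨h1, -, h3⟩ := hasSum_convolution hf.summable hg'.summable
    rw [hf.tsum_eq, hg'.tsum_eq] at h3
    have key : ∀ d i : ℤ, (z * phase 1 ψ) ^ i * bilateralTheta q β γ i φ *
        ((fun n : ℤ => (s * phase (-1) ψ) ^ n * bilateralTheta q β γ n φ) ∘ Equiv.neg ℤ) (d - i) =
        s ^ (-d) * phase d ψ * (bilateralTheta q β γ i φ *
          bilateralTheta q β γ (i - d) φ * (z * s) ^ i) := by
      intro d i
      have hp := phase_ne_zero 1 ψ
      have hs0 := hs.ne_zero
      simp only [Function.comp_apply, Equiv.neg_apply]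
      rw [neg_sub, mul_zpow, mul_zpow, mul_zpow, phase_eq_zpow (-1), phase_eq_zpow d, zpow_neg_one,
        inv_zpow, ← zpow_neg, neg_sub, show s ^ (i - d) = s ^ i * s ^ (-d) by
          rw [← zpow_add₀ hs0]; rfl, show phase 1 ψ ^ d = phase 1 ψ ^ i * phase 1 ψ ^ (d - i) by
          rw [← zpow_add₀ hp]; congr 1; ring]
      ring
    simp_rw [key] at h1 h3
    refine ⟨h1, h3.congr_fun fun d => ?_⟩
    rw [tsum_mul_left]
    ring
  refine ⟨fun d => ?_, ?_, fun ψ => (main ψ).2⟩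
  · exact (summable_mul_left_iff (mul_ne_zero (zpow_ne_zero _ hs.ne_zero) (phase_ne_zero d 0))).mp
      ((main 0).1 d)
  · refine (main 0).2.summable.congr fun d => ?_
    simp [phase_apply]

/-- The ratio of the constants in Ramanujan's sums for the parameters `γ` and `1`. -/
noncomputable def psiConst (q β γ : ℂ) : ℂ :=
  qShiftedInf q q * qShiftedInf (q / β) q / (qShiftedInf (q * γ) q * qShiftedInf (q / (β * γ)) q)

/-- The choice of `z * s` makes `βγz = q/(βs)` and `βγs = q/(βz)`: the numerator factors that
contain `γ` become factors free of `γ`, half of which cancel the denominators. -/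
theorem psiValue_mul_psiValue (hq : ‖q‖ < 1) (ha : ‖q‖ < ‖β * γ‖)
    {z s : ℂ} (hz : InAnnulus q β z) (hs : InAnnulus q β s) (hzs : z * s = q / (β ^ 2 * γ)) :
    psiValue q β γ z * psiValue q β γ s =
      psiConst q β γ ^ 2 * (psiValue q β 1 z * psiValue q β 1 s) := by
  have hγ := ne_zero_of_norm_lt_mul ha
  have hβ := hz.left_ne_zero
  have hz0 := hz.ne_zero
  have hs0 := hs.ne_zero
  have hzs' : z * s * (β ^ 2 * γ) = q := by
    rw [hzs]
    field_simp
  have hq0 : q ≠ 0 := by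
    rw [← hzs']
    positivity
  have hqβ : ‖q / β‖ < 1 := by
    rw [show q / β = q / (β * z) * z by field_simp, norm_mul]
    exact mul_lt_one_of_nonneg_of_lt_one_left (norm_nonneg _) hz.norm_div_lt hz.2.le
  have e1 : β * γ * z = q / (β * s) := by
    field_simp
    linear_combination hzs'
  have e2 : β * γ * s = q / (β * z) := by
    field_simp
    linear_combination hzs'
  have n1 := qShiftedInf_ne_zero hq hz.norm_div_lt
  have n2 := qShiftedInf_ne_zero hq hs.norm_div_lt
  have n3 := qShiftedInf_ne_zero hq hz.2
  have n4 := qShiftedInf_ne_zero hq hs.2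
  have n5 := qShiftedInf_ne_zero hq hq
  have n6 := qShiftedInf_ne_zero hq hqβ
  simp only [psiValue, psiConst, e1, e2, mul_one]
  generalize qShiftedInf (q / (β * s)) q = a1 at *
  generalize qShiftedInf (q / (β * z)) q = a2 at *
  generalize qShiftedInf (q / (β * γ)) q = a3 at *
  generalize qShiftedInf (q / β) q = a4 at *
  field_simp

theorem shifted_tsum_eq (hq0 : q ≠ 0) (hq : ‖q‖ < 1) (ha : ‖q‖ < ‖β * γ‖) (hβ : ‖q‖ < ‖β‖)
    (hb : ‖q * γ‖ < 1) {z s : ℂ} (hz : InAnnulus q β z) (hs : InAnnulus q β s)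
    (hzs : z * s = q / (β ^ 2 * γ)) (φ : ℝ) (d : ℤ) :
    ∑' i : ℤ, bilateralTheta q β γ i φ * bilateralTheta q β γ (i - d) φ * (z * s) ^ i =
      psiConst q β γ ^ 4 *
      ∑' i : ℤ, bilateralTheta q β 1 i φ * bilateralTheta q β 1 (i - d) φ * (z * s) ^ i := by
  obtain ⟨-, s1, h1⟩ := hasSum_shifted_product hq0 hq ha hb hz hs φ
  obtain ⟨-, s2, h2⟩ := hasSum_shifted_product (γ := 1) hq0 hq (by simpa using hβ)
    (by simpa using hq) hz hs φ
  have h := congr_fun (phase_series_unique s1 (s2.mul_left (psiConst q β γ ^ 4)) fun ψ => by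
    simp_rw [mul_assoc (psiConst q β γ ^ 4)]
    rw [tsum_mul_left, (h1 ψ).tsum_eq, (h2 ψ).tsum_eq]
    have p1 := psiValue_mul_psiValue hq ha ((hz.mul_phase 1 ψ).mul_phase (-1) φ)
      ((hs.mul_phase (-1) ψ).mul_phase 1 φ) (by
        have hp := phase_ne_zero 1 ψ
        have hp' := phase_ne_zero 1 φ
        rw [phase_eq_zpow (-1), phase_eq_zpow (-1), zpow_neg_one, zpow_neg_one, ← hzs]
        field_simp)
    have p2 := psiValue_mul_psiValue hq ha ((hz.mul_phase 1 ψ).mul_phase 1 φ)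
      ((hs.mul_phase (-1) ψ).mul_phase (-1) φ) (by
        have hp := phase_ne_zero 1 ψ
        have hp' := phase_ne_zero 1 φ
        rw [phase_eq_zpow (-1), phase_eq_zpow (-1), zpow_neg_one, zpow_neg_one, ← hzs]
        field_simp)
    -- The four factors are paired so that the phases cancel and each pair of arguments has product
    -- `z * s`; each pair yields `psiConst ^ 2`.
    calc _ = (psiValue q β γ (z * phase 1 ψ * phase (-1) φ) *
          psiValue q β γ (s * phase (-1) ψ * phase 1 φ)) *
          (psiValue q β γ (z * phase 1 ψ * phase 1 φ) *
          psiValue q β γ (s * phase (-1) ψ * phase (-1) φ)) := by ring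
      _ = _ := by
        rw [p1, p2]
        ring) d
  refine mul_left_cancel₀ (zpow_ne_zero (-d) hs.ne_zero) ?_
  rw [h]
  ring

end Shift

/-! ### Rogers polynomials: recurrence, abstract orthogonality and moments. -/

section Orthogonality

variable {q β : ℂ}

/-- The continuous `q`-ultraspherical (Rogers) polynomial `C_n(cos φ; β | q)` as a continuous
function of `φ`; it is zero for negative `n`. -/
noncomputable def rogers (q β : ℂ) (n : ℤ) : C(ℝ, ℂ) :=
  ∑ k ∈ Finset.Icc 0 n, (qRatio β q q k * qRatio β q q (n - k)) • phase (n - 2 * k)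

theorem hasSum_rogers (hq0 : q ≠ 0) (n : ℤ) (φ : ℝ) :
    HasSum (fun k : ℤ => qRatio β q q k * qRatio β q q (n - k) * phase (n - 2 * k) φ)
      (rogers q β n φ) := by
  have e : rogers q β n φ = ∑ k ∈ Finset.Icc 0 n,
      qRatio β q q k * qRatio β q q (n - k) * phase (n - 2 * k) φ := by
    simp [rogers]
  rw [e]
  refine hasSum_sum_of_ne_finset_zero fun k hk => ?_
  rw [Finset.mem_Icc, not_and_or, not_le, not_le] at hk
  rcases hk with hk | hk
  · rw [qRatio_q_of_neg β q hq0 hk]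
    ring
  · rw [qRatio_q_of_neg β q hq0 (sub_neg.mpr hk)]
    ring

theorem bilateralTheta_one (hq0 : q ≠ 0) (n : ℤ) (φ : ℝ) :
    bilateralTheta q β 1 n φ = rogers q β n φ := by
  rw [← (hasSum_rogers hq0 n φ).tsum_eq, bilateralTheta]
  refine tsum_congr fun k => ?_
  rw [bilateralTerm_eq, mul_one, mul_one]

theorem rogers_of_neg {n : ℤ} (hn : n < 0) : rogers q β n = 0 := by
  rw [rogers, Finset.Icc_eq_empty (not_le.mpr hn), Finset.sum_empty]

@[simp] theorem rogers_zero : rogers q β 0 = 1 := by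
  simp [rogers]

theorem rogers_rec (hq0 : q ≠ 0) (hq : ‖q‖ < 1) (hβ : ‖q‖ < ‖β‖) (n : ℤ) :
    (1 - q ^ (n + 1)) • rogers q β (n + 1) =
      (1 - β * q ^ n) • ((phase 1 + phase (-1)) * rogers q β n) -
        (1 - β ^ 2 * q ^ (n - 1)) • rogers q β (n - 1) := by
  ext φ
  simp only [ContinuousMap.smul_apply, ContinuousMap.sub_apply, ContinuousMap.mul_apply,
    ContinuousMap.add_apply, smul_eq_mul]
  have h1 := hasSum_rogers (β := β) hq0 (n + 1) φ
  have h2 := hasSum_rogers (β := β) hq0 n φ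
  have h3 := (Equiv.subRight (1 : ℤ)).hasSum_iff.mpr h2
  have h4 := (Equiv.subRight (1 : ℤ)).hasSum_iff.mpr (hasSum_rogers (β := β) hq0 (n - 1) φ)
  have h5 := (((h2.mul_left (phase 1 φ)).add (h3.mul_left (phase (-1) φ))).mul_left
    (1 - β * q ^ n)).sub (h4.mul_left (1 - β ^ 2 * q ^ (n - 1)))
  rw [add_mul]
  refine (h1.mul_left (1 - q ^ (n + 1))).unique (h5.congr_fun fun k => ?_)
  simp only [Function.comp_apply, Equiv.subRight_apply]
  have e1 : phase 1 φ * phase (n - 2 * k) φ = phase (n + 1 - 2 * k) φ := by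
    rw [← ContinuousMap.mul_apply, ← phase_add]
    congr 2
    ring
  have e2 : phase (-1) φ * phase (n - 2 * (k - 1)) φ = phase (n + 1 - 2 * k) φ := by
    rw [← ContinuousMap.mul_apply, ← phase_add]
    congr 2
    ring
  have e3 : phase (n - 1 - 2 * (k - 1)) φ = phase (n + 1 - 2 * k) φ := by
    congr 2
    ring
  have hs : ∀ k : ℤ, qRatio β q q k - qRatio β q q (k - 1) =
      q ^ k * (qRatio β q q k - β / q * qRatio β q q (k - 1)) := by
    intro k
    have h := qRatio_succ hq hβ hq (k - 1)
    rw [sub_add_cancel, zpow_sub_one₀ hq0] at h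
    field_simp at h ⊢
    linear_combination h
  have hk := hs k
  have hl := hs (n + 1 - k)
  have hp : q ^ k * q ^ (n + 1 - k) = q * q ^ n := by
    rw [← zpow_add₀ hq0, show k + (n + 1 - k) = n + 1 by ring, zpow_add_one₀ hq0, mul_comm]
  rw [show n + 1 - k - 1 = n - k by ring] at hl
  rw [show n - (k - 1) = n + 1 - k by ring, show n - 1 - (k - 1) = n - k by ring, e3,
    zpow_add_one₀ hq0, zpow_sub_one₀ hq0]
  generalize qRatio β q q k = x at *
  generalize qRatio β q q (k - 1) = x' at *
  generalize qRatio β q q (n + 1 - k) = y at *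
  generalize qRatio β q q (n - k) = y' at *
  -- The coefficient recurrences at `k` and at `n + 1 - k` are multiplied: the powers of `q` combine
  -- to `q^{n+1}`, independent of `k`, so expanding the product gives the three-term recurrence mode
  -- by mode.
  have main : (x - x') * (y - y') = q * q ^ n * ((x - β / q * x') * (y - β / q * y')) := by
    rw [hk, hl, ← hp]
    ring
  have main' : (1 - q ^ n * q) * (x * y) = (1 - β * q ^ n) * (x * y' + x' * y) -
      (1 - β ^ 2 * (q ^ n * q⁻¹)) * (x' * y') := by
    field_simp at main ⊢
    linear_combination main
  linear_combination phase (n + 1 - 2 * k) φ * main' -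
    (1 - β * q ^ n) * x * y' * e1 - (1 - β * q ^ n) * x' * y * e2

/-- The squared norm of the `n`-th Rogers polynomial, divided by the one for `n = 0`. -/
noncomputable def rogersNorm (q β : ℂ) (n : ℤ) : ℂ :=
  qRatio (β ^ 2) q q n * qRatio β (q * β) q n

theorem rogersNorm_of_neg (hq0 : q ≠ 0) {n : ℤ} (hn : n < 0) : rogersNorm q β n = 0 := by
  rw [rogersNorm, qRatio_q_of_neg _ q hq0 hn, zero_mul]

theorem rogersNorm_succ (hq0 : q ≠ 0) (hq : ‖q‖ < 1) (hβ1 : ‖β‖ < 1)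
    {m : ℤ} (hm : -1 ≤ m) :
    (1 - q ^ (m + 1)) * (1 - β * q ^ (m + 1)) * rogersNorm q β (m + 1) =
      (1 - β ^ 2 * q ^ m) * (1 - β * q ^ m) * rogersNorm q β m := by
  rcases hm.eq_or_lt with rfl | hm
  · simp [rogersNorm_of_neg hq0]
  · lift m to ℕ using by omega
    have hqβ : ‖q * β‖ < 1 := by
      rw [norm_mul]
      exact mul_lt_one_of_nonneg_of_lt_one_left (norm_nonneg _) hq hβ1.le
    have h1 := qShifted_natCast_ne_zero hq hq m
    have h2 := one_sub_mul_pow_ne_zero hq hq m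
    have h3 := qShifted_natCast_ne_zero hq hqβ m
    have h4 := one_sub_mul_pow_ne_zero hq hqβ m
    simp only [rogersNorm, qRatio, qShifted_natCast_succ]
    rw [zpow_add_one₀ hq0, zpow_natCast, show q ^ m * q = q * q ^ m by ring,
      show β * (q * q ^ m) = q * β * q ^ m by ring]
    generalize 1 - q * β * q ^ m = x at *
    field_simp

/-- Favard-type orthogonality: a linear functional that vanishes on all Rogers polynomials of
positive degree makes them orthogonal. -/
theorem rogers_orthogonality (hq0 : q ≠ 0) (hq : ‖q‖ < 1) (hβ : ‖q‖ < ‖β‖) (hβ1 : ‖β‖ < 1)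
    (L : C(ℝ, ℂ) →ₗ[ℂ] ℂ) (hL : ∀ n : ℤ, 0 < n → L (rogers q β n) = 0) (m : ℤ) (hm : -1 ≤ m) :
    ∀ n : ℤ, -1 ≤ n →
      L (rogers q β m * rogers q β n) = if m = n then L 1 * rogersNorm q β n else 0 := by
  have base : ∀ n : ℤ, -1 ≤ n →
      L (rogers q β (-1) * rogers q β n) = if -1 = n then L 1 * rogersNorm q β n else 0 := by
    intro n _
    rw [rogers_of_neg (n := -1) (by norm_num), zero_mul, map_zero]
    split_ifs with h
    · rw [rogersNorm_of_neg hq0 (by omega), mul_zero]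
    · rfl
  have base0 : ∀ n : ℤ, -1 ≤ n →
      L (rogers q β 0 * rogers q β n) = if 0 = n then L 1 * rogersNorm q β n else 0 := by
    intro n _
    rw [rogers_zero, one_mul]
    split_ifs with h
    · simp [← h, rogersNorm]
    · rcases lt_or_gt_of_ne h with h | h
      · exact hL n h
      · rw [rogers_of_neg h, map_zero]
  have hne : ∀ k : ℕ, 1 - q ^ ((k : ℤ) + 1) ≠ 0 := fun k => by
    have := one_sub_mul_pow_ne_zero hq hq k
    rwa [← pow_succ', ← zpow_natCast, Nat.cast_succ] at this
  have hne' : ∀ k : ℕ, 1 - β * q ^ (k : ℤ) ≠ 0 := fun k => by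
    simpa using one_sub_mul_pow_ne_zero hq hβ1 k
  -- Two consecutive rows are carried through the induction. Starting at index `-1`, where the
  -- polynomial is zero, lets the recurrence apply at `0` without a special case.
  have step : ∀ m : ℕ, ∀ n : ℤ, -1 ≤ n →
      (L (rogers q β (m - 1 : ℤ) * rogers q β n) =
        if (m - 1 : ℤ) = n then L 1 * rogersNorm q β n else 0) ∧
      (L (rogers q β m * rogers q β n) = if (m : ℤ) = n then L 1 * rogersNorm q β n else 0) := by
    intro m
    induction m with
    | zero => exact fun n hn => ⟨by simpa using base n hn, by simpa using base0 n hn⟩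
    | succ m ih =>
      intro n hn
      refine ⟨by simpa using (ih n hn).2, ?_⟩
      rw [Nat.cast_succ]
      rcases hn.eq_or_lt with rfl | hn'
      · rw [rogers_of_neg (n := -1) (by norm_num), mul_zero, map_zero, if_neg (by omega)]
      · lift n to ℕ using by omega
        have i1 := (ih n hn).1
        have i2 := (ih (n + 1) (by omega)).2
        have i3 := (ih (n - 1) (by omega)).2
        have r1 := congr_arg (fun f => L (f * rogers q β n)) (rogers_rec hq0 hq hβ m)
        have r2 := congr_arg (fun f => L (rogers q β m * f)) (rogers_rec hq0 hq hβ n)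
        simp only [sub_mul, mul_sub, smul_mul_assoc, mul_smul_comm, map_sub, map_smul,
          smul_eq_mul] at r1 r2
        rw [mul_left_comm, ← mul_assoc] at r2
        refine mul_left_cancel₀ (mul_ne_zero (hne m) (hne' n)) ?_
        -- Multiplication by `2 cos φ` can be absorbed by either factor; eliminating `L(2 cos φ ·
        -- C_m · C_n)` between the two recurrences expresses row `m + 1` through rows `m` and `m -
        -- 1`.
        have key : (1 - q ^ ((m : ℤ) + 1)) * (1 - β * q ^ (n : ℤ)) *
            L (rogers q β (m + 1) * rogers q β n) =
            (1 - β * q ^ (m : ℤ)) * ((1 - q ^ ((n : ℤ) + 1)) *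
              L (rogers q β m * rogers q β (n + 1)) + (1 - β ^ 2 * q ^ ((n : ℤ) - 1)) *
              L (rogers q β m * rogers q β (n - 1))) -
            (1 - β * q ^ (n : ℤ)) * (1 - β ^ 2 * q ^ ((m : ℤ) - 1)) *
              L (rogers q β (m - 1) * rogers q β n) := by
          linear_combination (1 - β * q ^ (n : ℤ)) * r1 - (1 - β * q ^ (m : ℤ)) * r2
        rw [key, i1, i2, i3]
        by_cases c1 : (m : ℤ) + 1 = n
        · have := rogersNorm_succ (β := β) hq0 hq hβ1 (m := m) (by omega)
          rw [← c1, if_neg (by omega), if_pos (by ring), if_neg (by omega), if_pos rfl]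
          rw [add_sub_cancel_right]
          linear_combination -L 1 * this
        · by_cases c2 : (m : ℤ) - 1 = n
          · have := rogersNorm_succ (β := β) hq0 hq hβ1 (m := m - 1) (by omega)
            rw [sub_add_cancel] at this
            rw [← c2, if_pos rfl, if_pos (by ring), if_neg (by omega), if_neg (by omega),
              sub_add_cancel]
            linear_combination L 1 * this
          · rw [if_neg c2, if_neg (by omega), if_neg (by omega), if_neg c1]
            ring
  rcases hm.eq_or_lt with rfl | hm'
  · exact base
  · lift m to ℕ using by omega
    exact fun n hn => (step m n hn).2

theorem qShifted_add_one {a : ℂ} (hq : ‖q‖ < 1) (ha : ‖q‖ < ‖a‖) (k : ℤ) :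
    qShifted a q (k + 1) = (1 - a * q ^ k) * qShifted a q k := by
  have h0 : ∀ k, qShifted 0 q k = 1 := by
    intro k
    cases k <;> simp [qShifted]
  simpa [qRatio, h0] using qRatio_succ (b := 0) hq ha (by simp) k

/-- Stated for the inverse because `1/(b;q)_k` stays meaningful at negative `k`, where factors `1 -
b q^{-j}` may vanish. -/
theorem inv_qShifted_eq {b : ℂ} (hq : ‖q‖ < 1) (hb : ‖b‖ < 1) (k : ℤ) :
    (qShifted b q k)⁻¹ = (1 - b * q ^ k) * (qShifted b q (k + 1))⁻¹ := by
  cases k with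
  | ofNat k =>
    have h1 := qShifted_natCast_ne_zero hq hb k
    have h2 := one_sub_mul_pow_ne_zero hq hb k
    rw [Int.ofNat_eq_natCast, qShifted_natCast_succ, zpow_natCast]
    field_simp
  | negSucc k =>
    have key : ∀ n : ℕ, (qShifted b q (-(n : ℤ)))⁻¹ =
        ∏ j ∈ Finset.range n, (1 - b * (q ^ (j + 1))⁻¹) := by
      intro n
      cases n with
      | zero => simp [qShifted]
      | succ n =>
        rw [show -((n + 1 : ℕ) : ℤ) = Int.negSucc n from rfl, qShifted_negSucc, inv_inv]
    have e : Int.negSucc k + 1 = -(k : ℤ) := by rw [Int.negSucc_eq]; ring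
    have e' : Int.negSucc k = -((k + 1 : ℕ) : ℤ) := by rw [Int.negSucc_eq]; push_cast; ring
    rw [e, e', key, key, Finset.prod_range_succ, zpow_neg, zpow_natCast, mul_comm]

theorem qRatio_q_natCast_succ (a : ℂ) (hq : ‖q‖ < 1) (k : ℕ) :
    (1 - q ^ (k + 1)) * qRatio a q q (k + 1) = (1 - a * q ^ k) * qRatio a q q k := by
  have h1 := qShifted_natCast_ne_zero hq hq k
  have h2 := one_sub_mul_pow_ne_zero hq hq k
  simp only [qRatio, qShifted_natCast_succ, pow_succ']
  field_simp

/-- A two-parameter array obeying the recurrence of the Rogers polynomials is given in closed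
form by its zeroth row. -/
theorem moment_array_eq (hq : ‖q‖ < 1) (hβ1 : ‖β‖ < 1) (hβ0 : β ≠ 0) (hq0 : q ≠ 0)
    {c : ℂ} {s : ℕ → ℤ → ℂ}
    (h0 : ∀ k, s 0 k = c * (β ^ k * qShifted β⁻¹ q k / qShifted β q k))
    (h1 : ∀ k, (1 - q) * s 1 k = (1 - β) * (s 0 k + s 0 (k + 1)))
    (hrec : ∀ n k, (1 - q ^ (n + 2)) * s (n + 2) k =
      (1 - β * q ^ (n + 1)) * (s (n + 1) k + s (n + 1) (k + 1)) -
        (1 - β ^ 2 * q ^ n) * s n (k + 1)) (n : ℕ) (k : ℤ) :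
    s n k = c * (qRatio (β ^ 2) q q n * β ^ k * qShifted β⁻¹ q k * (qShifted β q (k + n))⁻¹ *
      ∏ i ∈ Finset.range n, (1 - q ^ (k + i))) := by
  have hβ' : ‖q‖ < ‖β⁻¹‖ := by
    rw [norm_inv]
    exact hq.trans ((one_lt_inv₀ (norm_pos_iff.mpr hβ0)).mpr hβ1)
  have hU := qShifted_add_one hq hβ'
  have hY := inv_qShifted_eq hq hβ1
  have hr := qRatio_q_natCast_succ (β ^ 2) hq
  induction n using Nat.twoStepInduction generalizing k with
  | zero => simp [h0, div_eq_mul_inv]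
  | one =>
    have hq1 : 1 - q ≠ 0 := one_sub_ne_zero_of_norm_lt_one hq
    have hr0 := hr 0
    simp only [Nat.cast_zero, zero_add, pow_one, pow_zero, mul_one, qRatio_zero] at hr0
    refine mul_left_cancel₀ hq1 ?_
    rw [h1, h0, h0, hU, div_eq_mul_inv, div_eq_mul_inv, hY k, zpow_add_one₀ hβ0]
    simp only [Nat.cast_one, Finset.range_one, Finset.prod_singleton, Nat.cast_zero, add_zero]
    generalize (qShifted β q (k + 1))⁻¹ = y
    generalize qShifted β⁻¹ q k = u
    have hb : β * β⁻¹ = 1 := mul_inv_cancel₀ hβ0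
    linear_combination (-c * β ^ k * u * y * (1 - q ^ k)) * hr0 -
      (1 - β) * c * β ^ k * u * y * q ^ k * hb
  | more n ih0 ih1 =>
    have hqn : 1 - q ^ (n + 2) ≠ 0 := by
      have := one_sub_mul_pow_ne_zero hq hq (n + 1)
      rwa [← pow_succ'] at this
    refine mul_left_cancel₀ hqn ?_
    have hra := hr n
    have hrb := hr (n + 1)
    have hYk := hY (k + n + 1)
    rw [hrec, ih1, ih1, ih0]
    have p1 : ∏ i ∈ Finset.range (n + 1), (1 - q ^ (k + i)) =
        (∏ i ∈ Finset.range n, (1 - q ^ (k + 1 + i))) * (1 - q ^ k) := by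
      rw [Finset.prod_range_succ']
      congr 1
      · refine Finset.prod_congr rfl fun i _ => ?_
        congr 2
        push_cast
        ring
      · simp
    have p2 : ∏ i ∈ Finset.range (n + 2), (1 - q ^ (k + i)) =
        (∏ i ∈ Finset.range n, (1 - q ^ (k + 1 + i))) * (1 - q ^ k) * (1 - q ^ (k + n + 1)) := by
      rw [Finset.prod_range_succ, p1, add_assoc k n 1, Nat.cast_succ]
    have p3 : ∏ i ∈ Finset.range (n + 1), (1 - q ^ (k + 1 + i)) =
        (∏ i ∈ Finset.range n, (1 - q ^ (k + 1 + i))) * (1 - q ^ (k + n + 1)) := by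
      rw [Finset.prod_range_succ, add_right_comm]
    have e1 : k + ((n + 1 : ℕ) : ℤ) = k + n + 1 := by push_cast; ring
    have e2 : k + 1 + ((n + 1 : ℕ) : ℤ) = k + n + 1 + 1 := by push_cast; ring
    have e3 : k + 1 + (n : ℤ) = k + n + 1 := by ring
    have e4 : k + ((n + 2 : ℕ) : ℤ) = k + n + 1 + 1 := by push_cast; ring
    have e5 : q ^ (k + n + 1) = q ^ k * (q ^ n * q) := by
      rw [zpow_add_one₀ hq0, zpow_add₀ hq0, zpow_natCast, mul_assoc]
    have hb : β * β⁻¹ = 1 := mul_inv_cancel₀ hβ0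
    rw [p1, p2, p3, e1, e2, e3, e4, hYk, hU, zpow_add_one₀ hβ0, e5]
    have e6 : ((n + 2 : ℕ) : ℤ) = ((n + 1 : ℕ) : ℤ) + 1 := by push_cast; ring
    rw [e6, Nat.cast_succ] at *
    generalize (qShifted β q (k + n + 1 + 1))⁻¹ = y
    generalize qShifted β⁻¹ q k = u
    generalize ∏ i ∈ Finset.range n, (1 - q ^ (k + 1 + i)) = p
    generalize qRatio (β ^ 2) q q (n : ℤ) = r0 at *
    generalize qRatio (β ^ 2) q q ((n : ℤ) + 1) = r1 at *
    generalize qRatio (β ^ 2) q q ((n : ℤ) + 1 + 1) = r2 at *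
    generalize q ^ k = K
    generalize β ^ k = B
    have hK : β * (1 - β⁻¹ * K) = β - K := by linear_combination -K * hb
    linear_combination (-c * B * u * y * p * (1 - K) * (1 - K * (q ^ n * q))) * hrb +
      (-c * β * B * (1 - β⁻¹ * K) * u * (1 - β * (K * (q ^ n * q))) * y * p) * hra * (-1) +
      c * B * u * y * p * r1 * ((1 - β * q ^ (n + 1)) * (1 - K * (q ^ n * q)) -
        (1 - q ^ (n + 1)) * (1 - β * (K * (q ^ n * q)))) * hK

end Orthogonality

/-! ### Fourier series of the weight and orthogonality of the Rogers polynomials. -/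

section Weight

variable {q β : ℂ}

/-- The constant term `(β, qβ;q)_∞ / (q, β²;q)_∞` of the Fourier series of the weight. -/
noncomputable def weightConst (q β : ℂ) : ℂ :=
  qShiftedInf β q * qShiftedInf (q * β) q / (qShiftedInf q q * qShiftedInf (β ^ 2) q)

/-- The coefficients of the Laurent series of `(y, q/y;q)_∞ / (βy, β/y;q)_∞`. -/
noncomputable def weightCoeff (q β : ℂ) (k : ℤ) : ℂ :=
  weightConst q β * (qRatio β⁻¹ β q k * β ^ k)

theorem hasSum_weightCoeff (hq0 : q ≠ 0) (hq : ‖q‖ < 1) (hβ0 : β ≠ 0) (hβ1 : ‖β‖ < 1)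
    {y : ℂ} (hy : ‖y‖ = 1) :
    HasSum (fun k => weightCoeff q β k * y ^ k)
      (qShiftedInf y q * qShiftedInf (q / y) q /
        (qShiftedInf (β * y) q * qShiftedInf (β / y) q)) := by
  have hy0 : y ≠ 0 := norm_pos_iff.mp (by rw [hy]; exact one_pos)
  have hβ' : ‖q‖ < ‖β⁻¹‖ := by
    rw [norm_inv]
    exact hq.trans ((one_lt_inv₀ (norm_pos_iff.mpr hβ0)).mpr hβ1)
  have e1 : β / (β⁻¹ * (β * y)) = β / y := by field_simp
  have e2 : β / β⁻¹ = β ^ 2 := by field_simp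
  have e3 : β⁻¹ * (β * y) = y := by field_simp
  have e4 : q / β⁻¹ = q * β := by field_simp
  have hqβ : ‖q * β‖ < 1 := by
    rw [norm_mul]
    exact mul_lt_one_of_nonneg_of_lt_one_left (norm_nonneg _) hq hβ1.le
  have hβ2 : ‖β ^ 2‖ < 1 := by
    rw [norm_pow]
    exact pow_lt_one₀ (norm_nonneg _) hβ1 two_ne_zero
  have hz : ‖β * y‖ < 1 := by rwa [norm_mul, hy, mul_one]
  have hz' : ‖β / y‖ < 1 := by rwa [norm_div, hy, div_one]
  have h := (hasSum_ramanujan hq0 hq hβ' hβ0 hβ1 (mul_ne_zero hβ0 hy0) hz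
    (by rwa [e1])).mul_left (weightConst q β)
  rw [e1, e2, e3, e4] at h
  have n1 := qShiftedInf_ne_zero hq hq
  have n2 := qShiftedInf_ne_zero hq hβ1
  have n3 := qShiftedInf_ne_zero hq hβ2
  have n4 := qShiftedInf_ne_zero hq hqβ
  have e : weightConst q β * (qShiftedInf q q * qShiftedInf (β ^ 2) q *
      (qShiftedInf y q * qShiftedInf (q / y) q) / (qShiftedInf β q * qShiftedInf (q * β) q *
        (qShiftedInf (β * y) q * qShiftedInf (β / y) q))) =
      qShiftedInf y q * qShiftedInf (q / y) q /
        (qShiftedInf (β * y) q * qShiftedInf (β / y) q) := by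
    have aux : ∀ A B X Y : ℂ, A ≠ 0 → B ≠ 0 → A / B * (B * X / (A * Y)) = X / Y := by
      intro A B X Y hA hB
      field_simp
    exact aux _ _ _ _ (mul_ne_zero n2 n4) (mul_ne_zero n1 n3)
  rw [e] at h
  refine h.congr_fun fun k => ?_
  rw [weightCoeff, mul_zpow]
  ring

theorem summable_weightCoeff (hq0 : q ≠ 0) (hq : ‖q‖ < 1) (hβ0 : β ≠ 0) (hβ1 : ‖β‖ < 1) :
    Summable (weightCoeff q β) := by
  simpa using (hasSum_weightCoeff hq0 hq hβ0 hβ1 (y := 1) (by simp)).summable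

/-- The function `(y, 1/y;q)_∞ / (βy, β/y;q)_∞` of `y = e^{2iφ}`. -/
noncomputable def weightFun (q β : ℂ) (φ : ℝ) : ℂ :=
  qShiftedInf (phase 2 φ) q * qShiftedInf (phase (-2) φ) q /
    (qShiftedInf (β * phase 2 φ) q * qShiftedInf (β * phase (-2) φ) q)

theorem phase_neg (n : ℤ) (φ : ℝ) : phase (-n) φ = (phase n φ)⁻¹ := by
  rw [phase_eq_zpow, phase_eq_zpow n, zpow_neg]

/-- Ramanujan's sum expands `(y, q/y;q)_∞ / (βy, β/y;q)_∞`; the weight has `1/y` in place of `q/y`,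
which accounts for the factor `1 - y⁻¹` with `y = e^{2iφ}`. -/
theorem exists_weight (hq0 : q ≠ 0) (hq : ‖q‖ < 1) (hβ0 : β ≠ 0) (hβ1 : ‖β‖ < 1) :
    ∃ V : C(ℝ, ℂ), (∀ φ, HasSum (fun k => weightCoeff q β k * phase (2 * k) φ) (V φ)) ∧
      (∀ φ, ((1 - phase (-2)) * V) φ = weightFun q β φ) ∧
      ∃ B, ∀ φ, ‖((1 - phase (-2)) * V) φ‖ ≤ B := by
  have hs := summable_weightCoeff hq0 hq hβ0 hβ1
  let V : C(ℝ, ℂ) := ⟨fun φ => ∑' k, weightCoeff q β k * phase (2 * k) φ,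
    continuous_tsum (fun k => continuous_const.mul (phase _).continuous) hs.norm
      fun k φ => by simp⟩
  have hp : ∀ (k : ℤ) φ, phase (2 * k) φ = phase 2 φ ^ k := fun k φ => by
    rw [phase_eq_zpow, phase_eq_zpow 2, zpow_mul]
  have hV : ∀ φ, HasSum (fun k => weightCoeff q β k * phase (2 * k) φ)
      (qShiftedInf (phase 2 φ) q * qShiftedInf (q / phase 2 φ) q /
        (qShiftedInf (β * phase 2 φ) q * qShiftedInf (β / phase 2 φ) q)) := fun φ => by
    simp_rw [hp]
    exact hasSum_weightCoeff hq0 hq hβ0 hβ1 (norm_phase 2 φ)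
  refine ⟨V, fun φ => (hV φ).summable.hasSum, fun φ => ?_,
    2 * ∑' k, ‖weightCoeff q β k‖, fun φ => ?_⟩
  · have : V φ = _ := (hV φ).tsum_eq
    rw [ContinuousMap.mul_apply, this, ContinuousMap.sub_apply, ContinuousMap.one_apply, weightFun,
      phase_neg, qShiftedInf_succ (phase 2 φ)⁻¹ hq]
    simp only [div_eq_mul_inv, mul_comm q]
    ring
  · rw [ContinuousMap.mul_apply, norm_mul]
    gcongr
    · refine (norm_sub_le _ _).trans ?_
      rw [norm_phase, ContinuousMap.one_apply, norm_one]
      norm_num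
    · refine (norm_tsum_le_tsum_norm ?_).trans_eq ?_
      · exact (hV φ).summable.norm
      · simp

theorem rogers_moment_rec (hq0 : q ≠ 0) (hq : ‖q‖ < 1) (hβ : ‖q‖ < ‖β‖)
    (M : C(ℝ, ℂ) →ₗ[ℂ] ℂ) (d : ℤ) (n k : ℤ) :
    (1 - q ^ (n + 1)) * M (phase (-2 * k - (n + 1) + d) * rogers q β (n + 1)) =
      (1 - β * q ^ n) * (M (phase (-2 * k - n + d) * rogers q β n) +
        M (phase (-2 * (k + 1) - n + d) * rogers q β n)) -
      (1 - β ^ 2 * q ^ (n - 1)) *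
        M (phase (-2 * (k + 1) - (n - 1) + d) * rogers q β (n - 1)) := by
  have h := congr_arg (fun f => M (phase (-2 * k - (n + 1) + d) * f)) (rogers_rec hq0 hq hβ n)
  simp only [mul_sub, mul_smul_comm, map_sub, map_smul, smul_eq_mul, add_mul, mul_add, map_add,
    ← mul_assoc, ← phase_add] at h
  rw [show -2 * k - (n + 1) + d + 1 = -2 * k - n + d by ring,
    show -2 * k - (n + 1) + d + -1 = -2 * (k + 1) - n + d by ring] at h
  rw [show -2 * (k + 1) - (n - 1) + d = -2 * k - (n + 1) + d by ring, h]
  ring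

/-- The modes enter in steps of two, so the recurrence closes up within each parity class, selected
by `d`. The final product vanishes for `-n < k ≤ 0`, which is the source of orthogonality. -/
theorem rogers_moment_eq (hq0 : q ≠ 0) (hq : ‖q‖ < 1) (hβ : ‖q‖ < ‖β‖) (hβ1 : ‖β‖ < 1)
    (M : C(ℝ, ℂ) →ₗ[ℂ] ℂ) (d : ℤ) (c : ℂ)
    (hM : ∀ k, M (phase (-2 * k + d)) = c * (β ^ k * qShifted β⁻¹ q k / qShifted β q k))
    (n : ℕ) (k : ℤ) :
    M (phase (-2 * k - n + d) * rogers q β n) =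
      c * (qRatio (β ^ 2) q q n * β ^ k * qShifted β⁻¹ q k * (qShifted β q (k + n))⁻¹ *
        ∏ i ∈ Finset.range n, (1 - q ^ (k + i))) := by
  have hβ0 : β ≠ 0 := norm_pos_iff.mp ((norm_nonneg q).trans_lt hβ)
  refine moment_array_eq (s := fun n k => M (phase (-2 * k - n + d) * rogers q β n)) hq hβ1 hβ0
    hq0 (fun k => ?_) (fun k => ?_) (fun n k => ?_) n k
  · simpa using hM k
  · have := rogers_moment_rec hq0 hq hβ M d 0 k
    rw [rogers_of_neg (n := 0 - 1) (by norm_num)] at this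
    simpa using this
  · have := rogers_moment_rec hq0 hq hβ M d (n + 1) k
    rw [add_sub_cancel_right, ← Nat.cast_succ, ← Nat.cast_succ] at this
    simpa only [zpow_natCast] using this

theorem rogers_weight_orthogonality (hq0 : q ≠ 0) (hq : ‖q‖ < 1) (hβ : ‖q‖ < ‖β‖)
    (hβ1 : ‖β‖ < 1) {V : C(ℝ, ℂ)}
    (hV : ∀ φ, HasSum (fun k => weightCoeff q β k * phase (2 * k) φ) (V φ)) (m n : ℤ) :
    circleMean (rogers q β m * rogers q β n * ((1 - phase (-2)) * V)) =
      if m = n then 2 * weightConst q β * rogersNorm q β n else 0 := by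
  have hβ0 : β ≠ 0 := norm_pos_iff.mp ((norm_nonneg q).trans_lt hβ)
  have hs := summable_weightCoeff hq0 hq hβ0 hβ1
  let M : C(ℝ, ℂ) →ₗ[ℂ] ℂ := circleMean ∘ₗ LinearMap.mulRight ℂ V
  let L : C(ℝ, ℂ) →ₗ[ℂ] ℂ := circleMean ∘ₗ LinearMap.mulRight ℂ ((1 - phase (-2)) * V)
  have hLM : ∀ f, L f = M f - M (phase (-2) * f) := fun f => by
    simp only [L, M, LinearMap.comp_apply, LinearMap.mulRight_apply]
    rw [← map_sub]
    congr 1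
    ring
  have hMp : ∀ i, M (phase i) = ∑' k, weightCoeff q β k * if i + 2 * k = 0 then 1 else 0 :=
    fun i => circleMean_phase_mul (fun k => 2 * k) hs hV i
  have hM0 : ∀ k, M (phase (-2 * k)) = weightCoeff q β k := fun k => by
    have e : ∀ j : ℤ, -2 * k + 2 * j = 0 ↔ j = k := fun j => by omega
    simp only [hMp, e, mul_ite, mul_one, mul_zero, tsum_ite_eq]
  have hM1 : ∀ k, M (phase (-2 * k + 1)) = 0 := fun k => by
    have e : ∀ j : ℤ, ¬ (-2 * k + 1 + 2 * j = 0) := fun j => by omega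
    simp only [hMp, e, if_false, mul_zero, tsum_zero]
  have hE := rogers_moment_eq hq0 hq hβ hβ1 M 0 (weightConst q β) (fun k => by
    rw [add_zero, hM0, weightCoeff, qRatio]
    ring)
  have hO := rogers_moment_eq hq0 hq hβ hβ1 M 1 0 (fun k => by rw [hM1, zero_mul])
  -- For `n = 2p` the two moments needed are those at `k = -p` and `k = 1 - p`, both in the
  -- vanishing range; for odd `n` all moments of the relevant parity are zero.
  have hL : ∀ n : ℤ, 0 < n → L (rogers q β n) = 0 := by
    intro n hn
    lift n to ℕ using hn.le
    rw [hLM]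
    rcases Nat.even_or_odd' n with ⟨p, rfl | rfl⟩
    · have h1 := hE (2 * p) (-p)
      have h2 := hE (2 * p) (1 - p)
      rw [Finset.prod_eq_zero (i := p) (Finset.mem_range.mpr (by omega)) (by simp),
        show -2 * -(p : ℤ) - ((2 * p : ℕ) : ℤ) + 0 = 0 by push_cast; ring, phase_zero, one_mul] at h1
      rw [Finset.prod_eq_zero (i := p - 1) (Finset.mem_range.mpr (by omega)) (by
          rw [show (1 - p : ℤ) + ((p - 1 : ℕ) : ℤ) = 0 by omega]
          simp),
        show -2 * (1 - (p : ℤ)) - ((2 * p : ℕ) : ℤ) + 0 = -2 by push_cast; ring] at h2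
      rw [h1, h2]
      ring
    · have h1 := hO (2 * p + 1) (-p)
      have h2 := hO (2 * p + 1) (1 - p)
      rw [show -2 * -(p : ℤ) - ((2 * p + 1 : ℕ) : ℤ) + 1 = 0 by push_cast; ring, phase_zero,
        one_mul] at h1
      rw [show -2 * (1 - (p : ℤ)) - ((2 * p + 1 : ℕ) : ℤ) + 1 = -2 by push_cast; ring] at h2
      rw [h1, h2]
      ring
  -- The Laurent coefficients at `0` and `1` are opposite, so their difference doubles the constant
  -- term.
  have hL1 : L 1 = 2 * weightConst q β := by
    have hβ' : ‖q‖ < ‖β⁻¹‖ := by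
      rw [norm_inv]
      exact hq.trans ((one_lt_inv₀ (norm_pos_iff.mpr hβ0)).mpr hβ1)
    have h := qRatio_succ hq hβ' hβ1 0
    have h0 := hM0 0
    have h1 := hM0 1
    have hb := one_sub_ne_zero_of_norm_lt_one hβ1
    simp only [mul_zero, phase_zero, mul_one, zero_add, zpow_zero, qRatio_zero, weightCoeff,
      zpow_one] at h h0 h1
    rw [hLM, h0, mul_one, h1]
    have : qRatio β⁻¹ β q 1 * β = -1 := by
      refine mul_left_cancel₀ hb ?_
      linear_combination β * h + mul_inv_cancel₀ hβ0 * (-1)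
    rw [this]
    ring
  change L (rogers q β m * rogers q β n) = _
  rw [← hL1]
  by_cases hm : -1 ≤ m
  · by_cases hn : -1 ≤ n
    · exact rogers_orthogonality hq0 hq hβ hβ1 L hL m hm n hn
    · rw [rogers_of_neg (n := n) (by omega), mul_zero, map_zero, if_neg (by omega)]
  · rw [rogers_of_neg (n := m) (by omega), zero_mul, map_zero]
    split_ifs with h
    · rw [rogersNorm_of_neg hq0 (by omega), mul_zero]
    · rfl

end Weight

/-! ### The substitution `x = cos θ`. -/

section ChangeOfVariables

open Set MeasureTheory in
theorem intervalIntegrable_comp_arccos (F : C(ℝ, ℂ)) :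
    IntervalIntegrable (fun x : ℝ => F (Real.arccos x) / ((Real.sqrt (1 - x ^ 2) : ℝ) : ℂ))
      volume (-1) 1 := by
  have h : IntervalIntegrable (fun x : ℝ => (((Real.sqrt (1 - x ^ 2))⁻¹ : ℝ) : ℂ))
      volume (-1) 1 := by
    have h0 := Polynomial.Chebyshev.intervalIntegrable_sqrt_one_sub_sq_inv
    simp only [Real.sqrt_inv] at h0
    exact ⟨h0.1.ofReal, h0.2.ofReal⟩
  refine (h.continuousOn_mul (F.continuous.comp Real.continuous_arccos).continuousOn).congr ?_
  intro x _
  simp [div_eq_mul_inv]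

theorem integral_comp_arccos (F : C(ℝ, ℂ)) :
    ∫ x in (-1 : ℝ)..1, F (Real.arccos x) / ((Real.sqrt (1 - x ^ 2) : ℝ) : ℂ) =
      ∫ θ in (0 : ℝ)..Real.pi, F θ := by
  have h := intervalIntegral.integral_deriv_smul_comp_of_deriv_nonpos (a := -1) (b := 1)
    (f := Real.arccos) (f' := fun x => -(1 / Real.sqrt (1 - x ^ 2))) (g := F)
    Real.continuous_arccos.continuousOn
    (fun x hx => by
      norm_num at hx
      exact Real.hasDerivAt_arccos (by linarith [hx.1]) (by linarith [hx.2]))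
    (fun x _ => by simp)
  rw [Real.arccos_neg_one, Real.arccos_one, intervalIntegral.integral_symm 0 Real.pi] at h
  rw [← neg_inj, ← h, ← intervalIntegral.integral_neg]
  refine intervalIntegral.integral_congr fun x _ => ?_
  simp only [Function.comp_apply, Complex.real_smul]
  push_cast
  ring

theorem integral_zero_pi_eq (F : C(ℝ, ℂ)) (hF : ∀ φ, F (2 * Real.pi - φ) = F φ) :
    1 / (2 * (Real.pi : ℂ)) * ∫ θ in (0 : ℝ)..Real.pi, F θ = circleMean F / 2 := by
  have h1 := intervalIntegral.integral_comp_sub_left (a := 0) (b := Real.pi) F (2 * Real.pi)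
  simp_rw [hF] at h1
  have h2 := intervalIntegral.integral_add_adjacent_intervals
    (F.continuous.intervalIntegrable (μ := MeasureTheory.volume) 0 Real.pi)
    (F.continuous.intervalIntegrable Real.pi (2 * Real.pi))
  rw [circleMean_apply, ← h2, h1, show 2 * Real.pi - Real.pi = Real.pi by ring, sub_zero]
  ring

end ChangeOfVariables

/-! ### Positivity of the weight for real parameters. -/

section Positivity

theorem conj_qShiftedInf (a : ℂ) {q : ℂ} (hq : ‖q‖ < 1) :
    (starRingEnd ℂ) (qShiftedInf a q) = qShiftedInf ((starRingEnd ℂ) a) ((starRingEnd ℂ) q) := by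
  unfold qShiftedInf
  rw [(qShiftedInf_multipliable a hq).map_tprod (starRingEnd ℂ) Complex.continuous_conj]
  simp

theorem qShiftedInf_mul_conj {a q : ℂ} (hq : ‖q‖ < 1) (hq' : (starRingEnd ℂ) q = q) :
    qShiftedInf a q * qShiftedInf ((starRingEnd ℂ) a) q =
      ((Complex.normSq (qShiftedInf a q) : ℝ) : ℂ) := by
  have h := conj_qShiftedInf a hq
  rw [hq'] at h
  rw [← h, Complex.mul_conj]

/-- For real `q` and `β` the factors at `e^{2iφ}` and `e^{-2iφ}` are complex conjugates, so the
weight is a quotient of squared moduli; the numerator is nonzero because `e^{2iφ} ≠ 1`. -/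
theorem weightFun_pos {q β : ℂ} (hq : ‖q‖ < 1) (hβ : ‖β‖ < 1) (hq' : q.im = 0) (hβ' : β.im = 0)
    {φ : ℝ} (h0 : 0 < φ) (h1 : φ < Real.pi) : ∃ r : ℝ, 0 < r ∧ weightFun q β φ = r := by
  have hqc := Complex.conj_eq_iff_im.mpr hq'
  have hβc := Complex.conj_eq_iff_im.mpr hβ'
  have hpc : (starRingEnd ℂ) (phase 2 φ) = phase (-2) φ := by
    rw [phase_neg, ← Complex.inv_eq_conj (norm_phase 2 φ)]
  refine ⟨Complex.normSq (qShiftedInf (phase 2 φ) q) /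
    Complex.normSq (qShiftedInf (β * phase 2 φ) q), ?_, ?_⟩
  · refine div_pos (Complex.normSq_pos.mpr ?_) (Complex.normSq_pos.mpr ?_)
    · rw [qShiftedInf_succ _ hq]
      refine mul_ne_zero ?_ (qShiftedInf_ne_zero hq (by simpa using hq))
      intro h
      have h2 : phase 2 φ = 1 := (sub_eq_zero.mp h).symm
      rw [phase_apply, Complex.exp_eq_one_iff] at h2
      obtain ⟨n, hn⟩ := h2
      have h3 : (φ : ℂ) = ((n * Real.pi : ℝ) : ℂ) := by
        have : (2 * Complex.I) * φ = (2 * Complex.I) * ((n * Real.pi : ℝ) : ℂ) := by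
          push_cast at hn ⊢
          linear_combination hn
        exact mul_left_cancel₀ (mul_ne_zero two_ne_zero Complex.I_ne_zero) this
      have h4 : φ = n * Real.pi := by exact_mod_cast h3
      have h5 : (0 : ℝ) < n := by
        by_contra hc
        nlinarith [Real.pi_pos]
      have h6 : (n : ℝ) < 1 := by
        by_contra hc
        nlinarith [Real.pi_pos]
      have h5' : 0 < n := by exact_mod_cast h5
      have h6' : n < 1 := by exact_mod_cast h6
      omega
    · exact qShiftedInf_ne_zero hq (by simpa using hβ)
  · rw [weightFun, ← hpc, qShiftedInf_mul_conj hq hqc]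
    have := qShiftedInf_mul_conj (a := β * phase 2 φ) hq hqc
    rw [map_mul, hβc] at this
    rw [this]
    push_cast
    rfl

theorem ultraWeight_eq (q β : ℂ) (x : ℝ) :
    ultraWeight q β x = weightFun q β (Real.arccos x) / ((Real.sqrt (1 - x ^ 2) : ℝ) : ℂ) := by
  have e1 : Complex.exp (2 * Complex.I * Real.arccos x) = phase 2 (Real.arccos x) := by
    rw [phase_apply]
    congr 1
    push_cast
    ring
  have e2 : Complex.exp (-(2 * Complex.I * Real.arccos x)) = phase (-2) (Real.arccos x) := by
    rw [phase_apply]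
    congr 1
    push_cast
    ring
  rw [ultraWeight, weightFun, e1, e2]

theorem ultraWeight_pos {q β : ℂ} (hq : ‖q‖ < 1) (hβ : ‖β‖ < 1) (hq' : q.im = 0)
    (hβ' : β.im = 0) {x : ℝ} (hx : x ∈ Set.Ioo (-1 : ℝ) 1) :
    0 < (ultraWeight q β x).re ∧ (ultraWeight q β x).im = 0 := by
  obtain ⟨r, hr, h⟩ := weightFun_pos hq hβ hq' hβ' (Real.arccos_pos.mpr hx.2)
    (Real.arccos_lt_pi.mpr hx.1)
  have hs : 0 < Real.sqrt (1 - x ^ 2) := Real.sqrt_pos.mpr (by nlinarith [hx.1, hx.2])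
  rw [ultraWeight_eq, h, ← Complex.ofReal_div]
  exact ⟨by simpa using div_pos hr hs, Complex.ofReal_im _⟩

end Positivity

/-! ### Termwise integration and the final evaluation. -/

section Main

variable {q β γ : ℂ}

theorem phi21Term_eq (q β z : ℂ) (k : ℕ) :
    phi21Term (β ^ 2) β (q * β) q z k = rogersNorm q β k * z ^ k := by
  rw [phi21Term, rogersNorm, qRatio, qRatio, div_mul_div_comm]

theorem summable_phi21Term (hq0 : q ≠ 0) (hq : ‖q‖ < 1) (hβ1 : ‖β‖ < 1) {z : ℂ} (hz : ‖z‖ < 1) :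
    Summable (phi21Term (β ^ 2) β (q * β) q z) := by
  have hqβ : ‖q * β‖ < 1 := by
    rw [norm_mul]
    exact mul_lt_one_of_nonneg_of_lt_one_left (norm_nonneg _) hq hβ1.le
  obtain ⟨M, hM⟩ := (tendsto_qRatio β hq hqβ).norm.bddAbove_range
  refine Summable.of_norm_bounded
    ((summable_qRatio_q_nat (β ^ 2) hq0 hq hz).norm.mul_left M) fun k => ?_
  rw [phi21Term_eq, rogersNorm, mul_right_comm, norm_mul, mul_comm]
  gcongr
  exact hM ⟨k, rfl⟩

theorem tsum_rogersNorm (hq0 : q ≠ 0) (z : ℂ) :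
    ∑' k : ℤ, rogersNorm q β k * z ^ k = phi21 (β ^ 2) β (q * β) q z := by
  rw [phi21]
  simp_rw [phi21Term_eq]
  have h := (Nat.cast_injective (R := ℤ)).tsum_eq
    (f := fun k : ℤ => rogersNorm q β k * z ^ k) (fun k hk => by
      by_contra hk'
      refine hk ?_
      simp only
      rw [rogersNorm_of_neg hq0, zero_mul]
      by_contra hk0
      exact hk' ⟨k.toNat, by simp; omega⟩)
  rw [← h]
  simp

/-- A square root of `q/(β²γ)` serves as both points: `|z| < 1` is the hypothesis on `β ^ 2 * γ`,
and `(βz)²γ = q` turns `|qγ| < 1` into `|q| < |βz|`. -/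
theorem exists_inAnnulus (hγ : ‖q * γ‖ < 1) (hβγ : ‖q‖ < ‖β ^ 2 * γ‖) (hq0 : q ≠ 0) :
    ∃ z s : ℂ, InAnnulus q β z ∧ InAnnulus q β s ∧ z * s = q / (β ^ 2 * γ) := by
  have hpos : 0 < ‖β ^ 2 * γ‖ := (norm_nonneg q).trans_lt hβγ
  set u := q / (β ^ 2 * γ) with hu
  have hu0 : u ≠ 0 := div_ne_zero hq0 (norm_pos_iff.mp hpos)
  have hu1 : ‖u‖ < 1 := by
    rw [hu, norm_div]
    exact (div_lt_one hpos).mpr hβγ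
  obtain ⟨z, hz⟩ := IsAlgClosed.exists_pow_nat_eq u (n := 2) two_pos
  have hz2 : ‖z‖ ^ 2 = ‖u‖ := by rw [← norm_pow, hz]
  have hzA : InAnnulus q β z := by
    refine ⟨?_, ?_⟩
    · refine lt_of_pow_lt_pow_left₀ 2 (norm_nonneg _) ?_
      have h1 : (β * z) ^ 2 * γ = q := by
        rw [mul_pow, hz, mul_right_comm, hu, mul_div_cancel₀ _ (norm_pos_iff.mp hpos)]
      have h2 : ‖β * z‖ ^ 2 * ‖q * γ‖ = ‖q‖ ^ 2 := by
        rw [← norm_pow, ← norm_mul, ← norm_pow]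
        congr 1
        linear_combination q * h1
      have h3 : 0 < ‖β * z‖ ^ 2 := by
        refine lt_of_le_of_ne (by positivity) fun h => ?_
        rw [← h, zero_mul] at h2
        exact hq0 (by simpa using h2.symm)
      rw [← h2]
      exact mul_lt_of_lt_one_right h3 hγ
    · refine lt_of_pow_lt_pow_left₀ 2 zero_le_one ?_
      rwa [hz2, one_pow]
  exact ⟨z, z, hzA, hzA, by rw [← sq, hz]⟩

/-- A bound for the `n`-th Rogers polynomial on the real line. -/
noncomputable def rogersBound (q β : ℂ) (n : ℤ) : ℝ :=
  ∑' k : ℤ, ‖qRatio β q q k * qRatio β q q (n - k)‖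

theorem norm_rogers_le (hq0 : q ≠ 0) (n : ℤ) (φ : ℝ) : ‖rogers q β n φ‖ ≤ rogersBound q β n := by
  have h := (hasSum_rogers (β := β) hq0 n φ)
  rw [← h.tsum_eq, rogersBound]
  refine (norm_tsum_le_tsum_norm h.summable.norm).trans_eq (tsum_congr fun k => ?_)
  rw [norm_mul _ (phase _ φ), norm_phase, mul_one]

theorem summable_rogersBound (hq0 : q ≠ 0) (hq : ‖q‖ < 1) (hβ : ‖q‖ < ‖β‖) {z : ℂ}
    (hz : InAnnulus q β z) (m : ℤ) : Summable fun k : ℤ => rogersBound q β (m + k) * ‖z‖ ^ k := by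
  have h := (bilateral_convolution (γ := 1) hq0 hq (by simpa using hβ) (by simpa using hq) hz
    0).2.1
  simp only [mul_one] at h
  have h' := ((Equiv.addLeft m).summable_iff.mpr h).mul_left (‖z‖ ^ (-m))
  refine h'.congr fun k => ?_
  have hz0 : ‖z‖ ≠ 0 := norm_ne_zero_iff.mpr hz.ne_zero
  simp only [Function.comp_apply, Equiv.coe_addLeft]
  rw [← mul_assoc, ← zpow_add₀ hz0, neg_add_cancel_left, rogersBound, mul_comm]

/-- The series is the diagonal of the product of two summable families, one at `|z|` and one at
`|s|`. -/
theorem summable_rogersBound_mul (hq0 : q ≠ 0) (hq : ‖q‖ < 1) (hβ : ‖q‖ < ‖β‖) {z s : ℂ}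
    (hz : InAnnulus q β z) (hs : InAnnulus q β s) (m n : ℤ) :
    Summable fun k : ℤ => rogersBound q β (m + k) * rogersBound q β (n + k) * ‖z * s‖ ^ k := by
  have h := summable_mul_of_summable_norm (summable_rogersBound hq0 hq hβ hz m).norm
    (summable_rogersBound hq0 hq hβ hs n).norm
  have h' := h.comp_injective (i := fun k : ℤ => (k, k)) fun a b hab => congr_arg Prod.fst hab
  refine h'.congr fun k => ?_
  simp only [Function.comp_apply]
  rw [norm_mul, mul_zpow]
  ring

theorem circleMean_rogers_series (hq0 : q ≠ 0) (hq : ‖q‖ < 1) (hβ : ‖q‖ < ‖β‖) (hβ1 : ‖β‖ < 1)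
    {z s : ℂ} (hz : InAnnulus q β z) (hs : InAnnulus q β s) {V : C(ℝ, ℂ)}
    (hV : ∀ φ, HasSum (fun k => weightCoeff q β k * phase (2 * k) φ) (V φ))
    {B : ℝ} (hB : ∀ φ, ‖((1 - phase (-2)) * V) φ‖ ≤ B) (m n : ℤ) :
    ∃ F : C(ℝ, ℂ), (∀ φ, F φ = (∑' k : ℤ, rogers q β (m + k) φ * rogers q β (n + k) φ *
        (z * s) ^ k) * ((1 - phase (-2)) * V) φ) ∧
      circleMean F = 2 * weightConst q β * phi21 (β ^ 2) β (q * β) q (z * s) *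
        (z * s)⁻¹ ^ n * if m = n then 1 else 0 := by
  have hu0 : z * s ≠ 0 := mul_ne_zero hz.ne_zero hs.ne_zero
  have hb := summable_rogersBound_mul hq0 hq hβ hz hs m n
  have hle : ∀ (k : ℤ) (φ : ℝ), ‖rogers q β (m + k) φ * rogers q β (n + k) φ * (z * s) ^ k‖ ≤
      rogersBound q β (m + k) * rogersBound q β (n + k) * ‖z * s‖ ^ k := fun k φ => by
    rw [norm_mul, norm_mul, norm_zpow]
    gcongr
    · exact (norm_nonneg _).trans (norm_rogers_le hq0 (m + k) φ)
    · exact norm_rogers_le hq0 _ φ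
    · exact norm_rogers_le hq0 _ φ
  let S : C(ℝ, ℂ) := ⟨fun φ => ∑' k : ℤ, rogers q β (m + k) φ * rogers q β (n + k) φ *
    (z * s) ^ k, continuous_tsum (fun k => by fun_prop) hb hle⟩
  have hS : ∀ φ, HasSum (fun k : ℤ => rogers q β (m + k) φ * rogers q β (n + k) φ * (z * s) ^ k)
      (S φ) := fun φ => (Summable.of_norm_bounded hb fun k => hle k φ).hasSum
  refine ⟨S * ((1 - phase (-2)) * V), fun φ => rfl, ?_⟩
  have h := hasSum_circleMean (F := S * ((1 - phase (-2)) * V))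
    (f := fun k : ℤ => (z * s) ^ k • (rogers q β (m + k) * rogers q β (n + k) *
      ((1 - phase (-2)) * V))) (hb.mul_right B)
    (fun k φ => by
      rw [ContinuousMap.smul_apply, ContinuousMap.mul_apply _ ((1 - phase (-2)) * V), smul_eq_mul,
        ← mul_assoc, norm_mul, mul_comm ((z * s) ^ k)]
      have := (norm_nonneg _).trans (hle k φ)
      gcongr
      · exact hle k φ
      · exact hB φ)
    (fun φ => by
      refine ((hS φ).mul_right (((1 - phase (-2)) * V) φ)).congr_fun fun k => ?_
      rw [ContinuousMap.smul_apply, ContinuousMap.mul_apply _ ((1 - phase (-2)) * V), smul_eq_mul,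
        ContinuousMap.mul_apply (rogers q β _)]
      ring)
  simp only [map_smul, rogers_weight_orthogonality hq0 hq hβ hβ1 hV, smul_eq_mul,
    add_left_inj] at h
  rw [← h.tsum_eq]
  split_ifs with hmn
  -- Shifting the index by `n` produces the factor `(z s)^{-n}` and leaves the power series of the
  -- squared norms.
  · rw [← tsum_rogersNorm hq0, ← (Equiv.addLeft n).tsum_eq (fun k => rogersNorm q β k * _),
      ← tsum_mul_left, ← tsum_mul_right, ← tsum_mul_right]
    refine tsum_congr fun k => ?_
    simp only [Equiv.coe_addLeft]
    rw [inv_zpow, ← zpow_neg, zpow_add₀ hu0, zpow_neg]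
    have := zpow_ne_zero n hu0
    field_simp
  · simp

theorem rogers_reflect (hq0 : q ≠ 0) (n : ℤ) (φ : ℝ) :
    rogers q β n (2 * Real.pi - φ) = rogers q β n φ := by
  rw [← bilateralTheta_one hq0, ← bilateralTheta_one hq0]
  refine bilateralTheta_eq_of_cos_eq q β 1 n ?_
  push_cast
  exact Complex.cos_two_pi_sub _

theorem weightFun_reflect (q β : ℂ) (φ : ℝ) :
    weightFun q β (2 * Real.pi - φ) = weightFun q β φ := by
  have h : ∀ n : ℤ, phase n (2 * Real.pi - φ) = phase (-n) φ := fun n => by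
    rw [phase_apply, phase_apply, Complex.exp_eq_exp_iff_exists_int]
    exact ⟨n, by push_cast; ring⟩
  rw [weightFun, weightFun, h, h, neg_neg]
  ring

end Main

theorem theorem3 (q β γ : ℂ) (hq0 : q ≠ 0) (hq1 : ‖q‖ < 1) (hβ : ‖β‖ < 1)
    (hγ : ‖q * γ‖ < 1) (hβγ : ‖q‖ < ‖β ^ 2 * γ‖) :
    -- the weight is a positive function when the parameters are real
    (q.im = 0 → β.im = 0 → ∀ x ∈ Set.Ioo (-1 : ℝ) 1,
      0 < (ultraWeight q β x).re ∧ (ultraWeight q β x).im = 0) ∧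
    -- all the series converge absolutely
    (∀ x ∈ Set.Icc (-1 : ℝ) 1, ∀ n : ℤ, Summable (bilateralTerm q β γ n (Real.arccos x))) ∧
    Summable (phi21Term (β ^ 2) β (q * β) q (q / (β ^ 2 * γ))) ∧
    ∀ m n : ℤ,
      (∀ x ∈ Set.Icc (-1 : ℝ) 1, Summable (shiftedTerm q β γ m n x)) ∧
      -- the integrand is integrable
      IntervalIntegrable
        (fun x : ℝ => (∑' k : ℤ, shiftedTerm q β γ m n x k) * ultraWeight q β x)
        MeasureTheory.volume (-1) 1 ∧
      -- shifted orthogonality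
      1 / (2 * (Real.pi : ℂ)) *
          ∫ x in (-1 : ℝ)..1, (∑' k : ℤ, shiftedTerm q β γ m n x k) * ultraWeight q β x =
        qShiftedInf q q ^ 3 * qShiftedInf (q / β) q ^ 4 *
              (qShiftedInf β q * qShiftedInf (q * β) q) /
            ((qShiftedInf (q * γ) q * qShiftedInf (q / (β * γ)) q) ^ 4 *
              qShiftedInf (β ^ 2) q) *
          phi21 (β ^ 2) β (q * β) q (q / (β ^ 2 * γ)) *
          (β ^ 2 * γ / q) ^ n * (if m = n then 1 else 0) := by
  obtain ⟨z, s, hz, hs, hzs⟩ := exists_inAnnulus hγ hβγ hq0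
  have hβ0 := hz.left_ne_zero
  have hqβ : ‖q‖ < ‖β‖ := hz.1.trans_le (by
    rw [norm_mul]
    exact mul_le_of_le_one_right (norm_nonneg _) hz.2.le)
  have ha : ‖q‖ < ‖β * γ‖ := hβγ.trans_le (by
    rw [sq, mul_assoc, norm_mul]
    exact mul_le_of_le_one_left (norm_nonneg _) hβ.le)
  have hu1 : ‖q / (β ^ 2 * γ)‖ < 1 := by
    rw [norm_div]
    exact (div_lt_one ((norm_nonneg q).trans_lt hβγ)).mpr hβγ
  have hu0 : z * s ≠ 0 := mul_ne_zero hz.ne_zero hs.ne_zero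
  refine ⟨fun h1 h2 x hx => ultraWeight_pos hq1 hβ h1 h2 hx,
    fun x _ n => (bilateral_convolution hq0 hq1 ha hγ hz _).1 n,
    summable_phi21Term hq0 hq1 hβ hu1, fun m n => ?_⟩
  -- The index difference is `d = m - n` and the summation index `i = m + k`; the prefactor
  -- compensates the shift in the power of `z * s`.
  have hterm : ∀ x k, (z * s) ^ (-m) * (bilateralTheta q β γ (m + k) (Real.arccos x) *
      bilateralTheta q β γ (m + k - (m - n)) (Real.arccos x) * (z * s) ^ (m + k)) =
      shiftedTerm q β γ m n x k := by
    intro x k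
    rw [shiftedTerm, bilateralC, bilateralC, ← hzs, show m + k - (m - n) = n + k by ring,
      zpow_add₀ hu0, zpow_neg]
    have := zpow_ne_zero m hu0
    field_simp
  obtain ⟨V, hV, hW, B, hB⟩ := exists_weight hq0 hq1 hβ0 hβ
  obtain ⟨F, hF, hFm⟩ := circleMean_rogers_series hq0 hq1 hqβ hβ hz hs hV hB m n
  have hsum : ∀ x, ∑' k : ℤ, shiftedTerm q β γ m n x k = psiConst q β γ ^ 4 *
      ∑' k : ℤ, rogers q β (m + k) (Real.arccos x) * rogers q β (n + k) (Real.arccos x) *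
        (z * s) ^ k := by
    intro x
    have h := shifted_tsum_eq hq0 hq1 ha hqβ hγ hz hs hzs (Real.arccos x) (m - n)
    rw [← (Equiv.addLeft m).tsum_eq, ← (Equiv.addLeft m).tsum_eq (fun i => _ * _ * (z * s) ^ i)]
      at h
    simp only [Equiv.coe_addLeft] at h
    simp_rw [← hterm x]
    rw [tsum_mul_left, h, mul_left_comm, ← tsum_mul_left]
    congr 1
    refine tsum_congr fun k => ?_
    rw [bilateralTheta_one hq0, bilateralTheta_one hq0, show m + k - (m - n) = n + k by ring,
      zpow_add₀ hu0, zpow_neg]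
    have := zpow_ne_zero m hu0
    field_simp
  have hint : ∀ x : ℝ, (∑' k : ℤ, shiftedTerm q β γ m n x k) * ultraWeight q β x =
      (psiConst q β γ ^ 4 • F) (Real.arccos x) / ((Real.sqrt (1 - x ^ 2) : ℝ) : ℂ) := by
    intro x
    rw [hsum, ultraWeight_eq, ContinuousMap.smul_apply, hF, hW, smul_eq_mul]
    ring
  have hrefl : ∀ φ, (psiConst q β γ ^ 4 • F) (2 * Real.pi - φ) = (psiConst q β γ ^ 4 • F) φ := by
    intro φ
    simp only [ContinuousMap.smul_apply, hF, hW, rogers_reflect hq0, weightFun_reflect]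
  refine ⟨fun x _ => ?_, ?_, ?_⟩
  · have h := (hasSum_shifted_product hq0 hq1 ha hγ hz hs (Real.arccos x)).1 (m - n)
    exact (((Equiv.addLeft m).summable_iff.mpr h).mul_left ((z * s) ^ (-m))).congr
      fun k => (hterm x k)
  · simp_rw [hint]
    exact intervalIntegrable_comp_arccos _
  · simp_rw [hint]
    have n1 := qShiftedInf_ne_zero hq1 hq1
    -- Passing from the half circle to the full circle gives a factor `1/2`, which cancels the `2`
    -- in front of `weightConst`.
    rw [integral_comp_arccos, integral_zero_pi_eq _ hrefl, map_smul, hFm, hzs, inv_div, psiConst,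
      weightConst, smul_eq_mul]
    generalize (if m = n then (1 : ℂ) else 0) = δ
    generalize (β ^ 2 * γ / q) ^ n = P
    generalize phi21 (β ^ 2) β (q * β) q (q / (β ^ 2 * γ)) = Φ
    generalize qShiftedInf (q / (β * γ)) q = a1
    generalize qShiftedInf (q / β) q = a2
    field_simp
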